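/- **Setting.** Let $n\ge 1$, let $\Omega\subset\mathbb R^n$ be a bounded domain and $Q=(0,1]^n$. Let $p:\mathbb R^n\to\mathbb R$ be measurable, $1$-periodic in each coordinate, with $1<\alpha\le p(x)\le\beta<\infty$ a.e. Let $a:\mathbb R^n\times\mathbb R^n\to\mathbb R^n$ be measurable and $1$-periodic in each coordinate in $x$ for every $\xi$, continuous in $\xi$ for a.e. $x$, and such that for a.e. $x$ $$(a(x,\xi)-a(x,\eta))\cdot(\xi-\eta)>0\ \ (\xi\ne\eta),\qquad a(x,\xi)\cdot\xi\ge C_1(|\xi|^{p(x)}-1),\qquad |a(x,\xi)|\le C_2(|\xi|^{p(x)-1}+1)$$ for all $\xi,\eta$, with constants $C_1,C_2>0$. For $\varepsilon>0$ put $p_\varepsilon(x)=p(x/\varepsilon)$, $a_\varepsilon(x,\xi)=a(x/\varepsilon,\xi)$. For a bounded measurable exponent $q\ge1$ let $W^{1,q(\cdot)}(\Omega)$ be the set of $u\in W^{1,1}(\Omega)$ with $\int_\Omega|u|^{q(x)}dx<\infty$ and $\int_\Omega|\nabla u|^{q(x)}dx<\infty$, and $W^{1,q(\cdot)}_0(\Omega)$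 the set of $u\in W_0^{1,1}(\Omega)$ (the closure of $C_c^\infty(\Omega)$ in $W^{1,1}(\Omega)$) with $\int_\Omega|\nabla u|^{q(x)}dx<\infty$, normed by the Luxemburg norm of $\nabla u$ in $L^{q(\cdot)}(\Omega)$; $W^{1,\alpha}_0(\Omega)$ is the case $q\equiv\alpha$. Let $W^{1,p(\cdot)}_{\mathrm{per}}(Q)$ be the set of periodic $v\in W^{1,1}_{\mathrm{loc}}(\mathbb R^n)$ with $\int_Q v\,dx=0$ and $\int_Q|\nabla v|^{p(x)}dx<\infty$, and put $$h(\xi)=\min_{v\in W^{1,p(\cdot)}_{\mathrm{per}}(Q)}\int_Q\frac{|\xi+\nabla v|^{p(x)}}{p(x)}\,dx,\qquad a_0(\xi)=\int_Q a(x,\xi+\nabla v_\xi)\,dx,$$ where $v_\xi\in W^{1,p(\cdot)}_{\mathrm{per}}(Q)$ solves $\int_Q a(x,\xi+\nabla v_\xi)\cdot\nabla\varphi\,dx=0$ for all $\varphi\in W^{1,p(\cdot)}_{\mathrm{per}}(Q)$. Let $W^h(\Omega)$ and $W^h_0(\Omega)$ be the sets of $u\in W^{1,1}(\Omega)$, respectively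 $u\in W^{1,1}_0(\Omega)$, with $h(\nabla u)\in L^1(\Omega)$. Put $A_\varepsilon u=-\mathrm{div}\,a_\varepsilon(x,\nabla u)$ and $A_0u=-\mathrm{div}\,a_0(\nabla u)$. Let $\alpha'=\alpha/(\alpha-1)$, and let $s>\frac{n\alpha'}{n+\alpha'}$ if $\alpha<n$, $s>1$ if $\alpha=n$, $s=1$ if $\alpha>n$. Let $f\in L^s(\Omega)$ and, for all $\varepsilon>0$, $\psi_\varepsilon\in W^{1,p_\varepsilon(\cdot)}(\Omega)$, $\psi_0\in W^h(\Omega)$, $\psi_\varepsilon^+\in W_0^{1,p_\varepsilon(\cdot)}(\Omega)$, $\psi_0^+\in W^h_0(\Omega)$. Suppose that for every $\varepsilon>0$ the positive part $(A_\varepsilon\psi_\varepsilon-f)^+$, taken in the order dual of $W^{1,p_\varepsilon(\cdot)}_0(\Omega)$, is a function in $L^s(\Omega)$, with $L^s(\Omega)$-norm bounded by a constant independent of $\varepsilon$. Let $$K_\varepsilon=\{v\in W_0^{1,p_\varepsilon(\cdot)}(\Omega):v\ge\psi_\varepsilon\text{ a.e.}\},\qquad K_0=\{v\in W_0^{h}(\Omega):v\ge\psi_0\text{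 a.e.}\},$$ and suppose that $K_\varepsilon\to K_0$ in the Mosco sense as $\varepsilon\to0^+$: every $v_0\in K_0$ is the limit in $W^{1,\alpha}_0(\Omega)$ of some $v_\varepsilon\in K_\varepsilon$, and whenever $\varepsilon_k\to0^+$, $v_k\in K_{\varepsilon_k}$, the norms of $v_k$ in $W^{1,p_{\varepsilon_k}(\cdot)}_0(\Omega)$ are bounded and $v_k\rightharpoonup v$ weakly in $W^{1,\alpha}_0(\Omega)$, then $v\in K_0$. Let $u_\varepsilon\in K_\varepsilon$ and $u_0\in K_0$ solve $$\int_\Omega a_\varepsilon(x,\nabla u_\varepsilon)\cdot\nabla(v-u_\varepsilon)\,dx\ge\int_\Omega f(v-u_\varepsilon)\,dx\ \ \forall v\in K_\varepsilon,\qquad \int_\Omega a_0(\nabla u_0)\cdot\nabla(v-u_0)\,dx\ge\int_\Omega f(v-u_0)\,dx\ \ \forall v\in K_0.$$ **Theorem.** Assume moreover that the distribution $A_0\psi_0-f$ is a signed Radon measure on $\Omega$ (a difference of two positive, locally finite Borel measures) whose Jordan positive part $(A_0\psi_0-f)^+$ is a function in $L^1(\Omega)$, that as $\varepsilon\to0^+$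 $$u_\varepsilon-\psi_\varepsilon\to u_0-\psi_0\ \text{ in }L^1(\Omega),\qquad (A_\varepsilon\psi_\varepsilon-f)^+\to(A_0\psi_0-f)^+\ \text{ in }L^1(\Omega),\qquad A_\varepsilon u_\varepsilon\to A_0u_0\ \text{ in }\mathcal D'(\Omega),$$ that $A_0\psi_0-f$ is non-degenerate: every Borel set $S\subset\Omega$ with $|S|>0$ has a Borel subset $S'$ with $$\int_{S'}d(A_0\psi_0-f)\neq0$$ (this holds in particular if $\int_S d(A_0\psi_0-f)\ne0$ for all such $S$), and that $$A_0u_0-f=(A_0\psi_0-f)\,\chi_0\quad\text{a.e. in }\Omega,$$ that is, the distribution $A_0u_0-f$ is the function $d\,\chi_0$, where $d$ is the density of the absolutely continuous part of the measure $A_0\psi_0-f$ and $\chi_0$ is the characteristic function of $\{u_0=\psi_0\}$. Then the characteristic functions $\chi_\varepsilon$ of the coincidence sets $\{u_\varepsilon=\psi_\varepsilon\}$ satisfy, as $\varepsilon\to0^+$, $$\chi_\varepsilon\to\chi_0\quad\text{in }L^r(\Omega)\ \text{ for every } r\in[1,\infty).$$ -/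

import Mathlib

open Set Filter Topology MeasureTheory TopologicalSpace
open scoped ENNReal Distributions RealInnerProductSpace

noncomputable section

namespace ObstacleHomogenization

/-- The space `ℝⁿ` with its Euclidean structure. -/
abbrev E (n : ℕ) := EuclideanSpace ℝ (Fin n)

/-! ### Weak gradients and Sobolev spaces -/

/-- `G` is the weak gradient of `u` in the open set `Ω`. -/
def HasWeakGrad {n : ℕ} (Ω : Opens (E n)) (u : E n → ℝ) (G : E n → E n) : Prop :=
  LocallyIntegrableOn u Ω ∧ LocallyIntegrableOn G Ω ∧
    ∀ φ : 𝓓(Ω, ℝ), ∫ x in Ω, u x • gradient (φ : E n → ℝ) x = -(∫ x in Ω, φ x • G x)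

open Classical in
/-- The weak gradient of `u` in `Ω` (unique up to null sets), and `0` if there is none. -/
def weakGrad {n : ℕ} (Ω : Opens (E n)) (u : E n → ℝ) : E n → E n :=
  if h : ∃ G, HasWeakGrad Ω u G then h.choose else 0

/-- The Sobolev space `W^{1,1}(Ω)`. -/
def W11 {n : ℕ} (Ω : Opens (E n)) : Set (E n → ℝ) :=
  {u | (∃ G, HasWeakGrad Ω u G) ∧ IntegrableOn u Ω ∧ IntegrableOn (weakGrad Ω u) Ω}

/-- The space `W^{1,1}_0(Ω)`, the closure of the test functions in `W^{1,1}(Ω)`. -/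
def W11Zero {n : ℕ} (Ω : Opens (E n)) : Set (E n → ℝ) :=
  {u | u ∈ W11 Ω ∧ ∃ φ : ℕ → 𝓓(Ω, ℝ),
    Tendsto (fun k => ∫ x in Ω, |u x - φ k x|) atTop (𝓝 0) ∧
    Tendsto (fun k => ∫ x in Ω, ‖weakGrad Ω u x - gradient (φ k : E n → ℝ) x‖) atTop (𝓝 0)}

/-- The space `W^{1,q(·)}(Ω)` (for a bounded `Ω` and `q ≥ 1`, where it lies in `W^{1,1}(Ω)`). -/
def W1 {n : ℕ} (Ω : Opens (E n)) (q : E n → ℝ) : Set (E n → ℝ) :=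
  {u | u ∈ W11 Ω ∧ IntegrableOn (fun x => |u x| ^ q x) Ω ∧
    IntegrableOn (fun x => ‖weakGrad Ω u x‖ ^ q x) Ω}

/-- The space `W^{1,q(·)}_0(Ω)` of all `u ∈ W^{1,1}_0(Ω)` with `∫ |∇u|^{q(x)} < ∞`. -/
def W1Zero {n : ℕ} (Ω : Opens (E n)) (q : E n → ℝ) : Set (E n → ℝ) :=
  {u | u ∈ W11Zero Ω ∧ IntegrableOn (fun x => ‖weakGrad Ω u x‖ ^ q x) Ω}

/-- The Luxemburg norm in `L^{q(·)}(Ω)` of a vector field. -/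
def luxNorm {n : ℕ} (Ω : Opens (E n)) (q : E n → ℝ) (F : E n → E n) : ℝ :=
  sInf {t : ℝ | 0 < t ∧ ∫⁻ x in Ω, ENNReal.ofReal ((‖F x‖ / t) ^ q x) ≤ 1}

/-! ### Periodic data, the cell problem and the homogenized objects -/

/-- `g` has period `1` in each coordinate. -/
def IsOnePeriodic {n : ℕ} {X : Type*} (g : E n → X) : Prop :=
  ∀ (i : Fin n) (x : E n), g (x + EuclideanSpace.single i 1) = g x

/-- The periodicity cell `Q = (0,1]ⁿ`. -/
def cell (n : ℕ) : Set (E n) := {x | ∀ i, x i ∈ Ioc (0 : ℝ) 1}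

/-- The space `W^{1,p(·)}_per(Q)`: periodic functions in `W^{1,1}_loc(ℝⁿ)` with mean zero over the
cell and `∫_Q |∇v|^{p(x)} < ∞`. -/
def WPer {n : ℕ} (p : E n → ℝ) : Set (E n → ℝ) :=
  {v | IsOnePeriodic v ∧ (∃ G, HasWeakGrad (⊤ : Opens (E n)) v G) ∧ (∫ x in cell n, v x) = 0 ∧
    IntegrableOn (fun x => ‖weakGrad (⊤ : Opens (E n)) v x‖ ^ p x) (cell n)}

/-- The homogenized functional
`h(ξ) = min { ∫_Q |ξ + ∇v|^{p(x)} / p(x) dx : v ∈ W^{1,p(·)}_per(Q) }`. -/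
def homFunctional {n : ℕ} (p : E n → ℝ) (ξ : E n) : ℝ :=
  sInf ((fun v : E n → ℝ =>
    ∫ x in cell n, ‖ξ + weakGrad (⊤ : Opens (E n)) v x‖ ^ p x / p x) '' WPer p)

/-- `v` solves the cell problem for `ξ`:
`∫_Q a(x, ξ + ∇v) · ∇φ dx = 0` for all `φ ∈ W^{1,p(·)}_per(Q)`. -/
def IsCellSolution {n : ℕ} (p : E n → ℝ) (a : E n → E n → E n) (ξ : E n) (v : E n → ℝ) : Prop :=
  v ∈ WPer p ∧ ∀ φ ∈ WPer p,
    ∫ x in cell n, ⟪a x (ξ + weakGrad (⊤ : Opens (E n)) v x),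
      weakGrad (⊤ : Opens (E n)) φ x⟫ = 0

open Classical in
/-- The homogenized vector field `a₀(ξ) = ∫_Q a(x, ξ + ∇v) dx`, where `v` solves the cell problem
for `ξ` (`∇v` is unique by strict monotonicity). -/
def homField {n : ℕ} (p : E n → ℝ) (a : E n → E n → E n) (ξ : E n) : E n :=
  if h : ∃ v, IsCellSolution p a ξ v then
    ∫ x in cell n, a x (ξ + weakGrad (⊤ : Opens (E n)) h.choose x)
  else 0

/-- The space `W^h(Ω)`. -/
def Wh {n : ℕ} (Ω : Opens (E n)) (h : E n → ℝ) : Set (E n → ℝ) :=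
  {u | u ∈ W11 Ω ∧ IntegrableOn (fun x => h (weakGrad Ω u x)) Ω}

/-- The space `W^h_0(Ω)`. -/
def WhZero {n : ℕ} (Ω : Opens (E n)) (h : E n → ℝ) : Set (E n → ℝ) :=
  {u | u ∈ W11Zero Ω ∧ IntegrableOn (fun x => h (weakGrad Ω u x)) Ω}

/-- The assumptions on the exponent `p` and on the vector field `a`: periodicity, measurability,
the bounds `1 < α ≤ p ≤ β`, the Carathéodory property, strict monotonicity, coercivity, growth. -/
structure StructureConditions {n : ℕ} (p : E n → ℝ) (a : E n → E n → E n) (α β C₁ C₂ : ℝ) :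
    Prop where
  one_lt : 1 < α
  C₁_pos : 0 < C₁
  C₂_pos : 0 < C₂
  p_meas : AEMeasurable p
  p_periodic : IsOnePeriodic p
  p_bounds : ∀ᵐ x, α ≤ p x ∧ p x ≤ β
  a_meas : ∀ ξ, AEMeasurable (fun x => a x ξ)
  a_cont : ∀ᵐ x, Continuous (a x)
  a_periodic : ∀ ξ, IsOnePeriodic (fun x => a x ξ)
  monotone : ∀ᵐ x, ∀ ξ η, ξ ≠ η → 0 < ⟪a x ξ - a x η, ξ - η⟫
  coercive : ∀ᵐ x, ∀ ξ, C₁ * (‖ξ‖ ^ p x - 1) ≤ ⟪a x ξ, ξ⟫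
  growth : ∀ᵐ x, ∀ ξ, ‖a x ξ‖ ≤ C₂ * (‖ξ‖ ^ (p x - 1) + 1)

/-- The rescaled exponent `p_ε(x) = p(x/ε)`. -/
def pEps {n : ℕ} (p : E n → ℝ) (ε : ℝ) : E n → ℝ := fun x => p (ε⁻¹ • x)

/-- The rescaled vector field `a_ε(x,ξ) = a(x/ε,ξ)`. -/
def aEps {n : ℕ} (a : E n → E n → E n) (ε : ℝ) : E n → E n → E n := fun x ξ => a (ε⁻¹ • x) ξ

/-- The condition on the exponent `s` of the data: `s > nα'/(n+α')` with `α' = α/(α-1)` if `α < n`,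
`s > 1` if `α = n`, and `s = 1` if `α > n`. -/
def DataExponent (n : ℕ) (α s : ℝ) : Prop :=
  (α < n → n * (α / (α - 1)) / (n + α / (α - 1)) < s) ∧ (α = n → 1 < s) ∧ (n < α → s = 1)

/-! ### Obstacle problems and Mosco convergence -/

/-- The elements `v` of `V` with `v ≥ ψ` a.e. in `Ω`. -/
def obstacleSet {n : ℕ} (Ω : Opens (E n)) (V : Set (E n → ℝ)) (ψ : E n → ℝ) : Set (E n → ℝ) :=
  {v | v ∈ V ∧ ∀ᵐ x ∂(volume.restrict (Ω : Set (E n))), ψ x ≤ v x}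

/-- `u ∈ K` solves `∫_Ω b(x,∇u) · ∇(v-u) ≥ ∫_Ω f (v-u)` for all `v ∈ K`. -/
def IsObstacleSolution {n : ℕ} (Ω : Opens (E n)) (K : Set (E n → ℝ)) (b : E n → E n → E n)
    (f u : E n → ℝ) : Prop :=
  u ∈ K ∧ ∀ v ∈ K, ∫ x in Ω, f x * (v x - u x) ≤
    ∫ x in Ω, ⟪b x (weakGrad Ω u x), weakGrad Ω (v - u) x⟫

/-- Weak convergence in `W^{1,α}(Ω)`, tested against `L^{α'}(Ω)`. -/
def WeakTendstoW1 {n : ℕ} (Ω : Opens (E n)) (α : ℝ) (v : ℕ → E n → ℝ) (v₀ : E n → ℝ) : Prop :=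
  (∀ ζ : E n → ℝ, MemLp ζ (ENNReal.ofReal (α / (α - 1))) (volume.restrict Ω) →
    Tendsto (fun k => ∫ x in Ω, v k x * ζ x) atTop (𝓝 (∫ x in Ω, v₀ x * ζ x))) ∧
  (∀ Z : E n → E n, MemLp Z (ENNReal.ofReal (α / (α - 1))) (volume.restrict Ω) →
    Tendsto (fun k => ∫ x in Ω, ⟪weakGrad Ω (v k) x, Z x⟫) atTop
      (𝓝 (∫ x in Ω, ⟪weakGrad Ω v₀ x, Z x⟫)))

/-- Mosco convergence, as `ε → 0⁺`, of `K ε ⊆ W^{1,p_ε(·)}_0(Ω)` to `K₀`: every element of `K₀` is a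
strong limit in `W^{1,α}_0(Ω)` of elements of `K ε`, and weak limits in `W^{1,α}_0(Ω)` of sequences
of elements of `K ε` which are bounded in `W^{1,p_ε(·)}_0(Ω)` belong to `K₀`. -/
def MoscoConverges {n : ℕ} (Ω : Opens (E n)) (p : E n → ℝ) (α : ℝ) (K : ℝ → Set (E n → ℝ))
    (K₀ : Set (E n → ℝ)) : Prop :=
  (∀ v₀ ∈ K₀, ∃ v : ℝ → E n → ℝ, (∀ ε, 0 < ε → v ε ∈ K ε) ∧
    Tendsto (fun ε => eLpNorm (v ε - v₀) (ENNReal.ofReal α) (volume.restrict Ω)) (𝓝[>] 0) (𝓝 0) ∧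
    Tendsto (fun ε => eLpNorm (weakGrad Ω (v ε) - weakGrad Ω v₀) (ENNReal.ofReal α)
      (volume.restrict Ω)) (𝓝[>] 0) (𝓝 0)) ∧
  (∀ (e : ℕ → ℝ) (v : ℕ → E n → ℝ) (v₀ : E n → ℝ) (M : ℝ),
    (∀ k, 0 < e k) → Tendsto e atTop (𝓝 0) → (∀ k, v k ∈ K (e k)) →
    (∀ k, luxNorm Ω (pEps p (e k)) (weakGrad Ω (v k)) ≤ M) →
    v₀ ∈ W1Zero Ω (fun _ => α) → WeakTendstoW1 Ω α v v₀ → v₀ ∈ K₀)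

/-! ### The functionals `A u - f` and their positive parts -/

/-- The functional `w ↦ ⟨A u - f, w⟩ = ∫_Ω b(x,∇u) · ∇w - ∫_Ω f w` on Sobolev functions, where
`A u = -div b(x,∇u)`. -/
def obstacleResidual {n : ℕ} (Ω : Opens (E n)) (b : E n → E n → E n) (f u w : E n → ℝ) : ℝ :=
  (∫ x in Ω, ⟪b x (weakGrad Ω u x), weakGrad Ω w x⟫) - (∫ x in Ω, f x * w x)

/-- The distribution `A u = -div b(x,∇u)` applied to a test function. -/
def divOp {n : ℕ} (Ω : Opens (E n)) (b : E n → E n → E n) (u : E n → ℝ) (φ : 𝓓(Ω, ℝ)) : ℝ :=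
  ∫ x in Ω, ⟪b x (weakGrad Ω u x), gradient (φ : E n → ℝ) x⟫

/-- The positive part, in the order dual of the lattice `V` of functions on `Ω`, of the linear
functional `T` is (integration against) the function `g`. This is the Riesz–Kantorovich formula
`T⁺(w) = sup { T(v) : v ∈ V, 0 ≤ v ≤ w }` for `0 ≤ w ∈ V`. -/
def IsPosPart {n : ℕ} (Ω : Opens (E n)) (V : Set (E n → ℝ)) (T : (E n → ℝ) → ℝ) (g : E n → ℝ) :
    Prop :=
  ∀ w ∈ V, (∀ᵐ x ∂(volume.restrict (Ω : Set (E n))), 0 ≤ w x) →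
    IsLUB {t : ℝ | ∃ v ∈ V, (∀ᵐ x ∂(volume.restrict (Ω : Set (E n))), 0 ≤ v x ∧ v x ≤ w x) ∧
      t = T v} (∫ x in Ω, g x * w x)

/-- `ν` is a positive Radon measure on `Ω`, extended by zero outside `Ω`. -/
def IsRadonOn {n : ℕ} (Ω : Opens (E n)) (ν : Measure (E n)) : Prop :=
  ν (Ω : Set (E n))ᶜ = 0 ∧ ∀ K : Set (E n), IsCompact K → K ⊆ Ω → ν K < ∞

/-- The distribution `T` on `Ω` is the signed Radon measure `μ - ν`, and `μ` and `ν` are the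
positive and negative parts in its Jordan decomposition. -/
def HasJordanDecomposition {n : ℕ} (Ω : Opens (E n)) (T : 𝓓(Ω, ℝ) → ℝ) (μ ν : Measure (E n)) :
    Prop :=
  IsRadonOn Ω μ ∧ IsRadonOn Ω ν ∧ μ ⟂ₘ ν ∧ ∀ φ : 𝓓(Ω, ℝ), T φ = (∫ x, φ x ∂μ) - (∫ x, φ x ∂ν)

/-- The measure `g dx` on `Ω`, for a nonnegative function `g`. -/
def densityMeasure {n : ℕ} (Ω : Opens (E n)) (g : E n → ℝ) : Measure (E n) :=
  (volume.restrict (Ω : Set (E n))).withDensity (fun x => ENNReal.ofReal (g x))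

/-- The coincidence set `{u = ψ}` in `Ω`. -/
def coincidenceSet {n : ℕ} (Ω : Opens (E n)) (u ψ : E n → ℝ) : Set (E n) :=
  {x | x ∈ Ω ∧ u x = ψ x}

end ObstacleHomogenization

end

open ObstacleHomogenization

namespace ObstacleHomogenization

open scoped Convolution
open ContinuousLinearMap (lsmul)

variable {n : ℕ} {Ω : Opens (E n)}

/-! ### Test functions -/

/-! Write `I_ε` and `I₀` for the coincidence sets. Since `‖1_S‖_r = |S|^{1/r}`, it is enough that
`|I_ε \ I₀| → 0` and `|I₀ \ I_ε| → 0`; the two halves have different causes.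

The first is soft. On `I_ε` the function `u_ε - ψ_ε` vanishes, so the integral of `|u₀ - ψ₀|` over
`I_ε \ I₀` is at most the `L¹` distance between `u_ε - ψ_ε` and `u₀ - ψ₀`. As `|u₀ - ψ₀| > 0` off
`I₀` and `Ω` has finite measure, the sets themselves become small
(`tendsto_measure_coincidenceSet_diff`).

The second uses the reaction `A_ε u_ε - f`. With `g_ε = (A_ε ψ_ε - f)⁺`, a localized
Lewy–Stampacchia inequality gives `0 ≤ A_ε u_ε - f ≤ g_ε χ_ε` as distributions
(`IsObstacleSolution.divOp_nonneg`, `IsObstacleSolution.divOp_le`). The lower bound survives in the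
limit, so the density `d = g₀ - dν/dx` is nonnegative a.e. on `I₀`. The Jordan parts have disjoint
densities and nondegeneracy excludes `d = 0`; hence `g₀ > 0` and `dν/dx = 0` a.e. on `I₀`
(`ae_density_pos_of_reaction_nonneg`), and the limit reaction is `g₀ χ₀`. The upper bound, tested
with `φ ≥ 0`, says that `g₀ χ₀` is asymptotically dominated by `g₀ χ_ε`. Because `I_ε \ I₀` is
negligible, this forces `∫ g₀ φ` over `I₀ \ I_ε` to tend to zero
(`tendsto_integral_indicator_diff`), and positivity of `g₀` on `I₀` turns this into smallness of
measure (`tendsto_measure_of_tendsto_integral_test`).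

The upper bound comes from the penalized functions `z = (φ - c w)⁺` with `w = u - ψ ≥ 0` and `c →
∞`. They concentrate on the contact set, and `φ - z ≤ c w` makes `u - (φ - z)/c` an admissible
competitor. Monotonicity of the field discards the term containing `c`, and the rest vanishes in the
limit because `∇u = ∇ψ` a.e. where `u = ψ`. The calculus behind this, namely the weak gradient of a
positive part and its vanishing on level sets, is derived from mollification. -/

theorem exists_cutoff {K : Set (E n)} (hK : IsCompact K) (hKΩ : K ⊆ Ω) :
    ∃ η : 𝓓(Ω, ℝ), (∀ x ∈ K, ∀ᶠ y in 𝓝 x, η y = 1) ∧ ∀ x, 0 ≤ η x ∧ η x ≤ 1 := by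
  -- Two nested compact neighbourhoods: the bump is `1` on `L`, hence near every point of `K`, so
  -- that its gradient vanishes on `K`; its support stays in `M`.
  obtain ⟨L, hL, hKL, hLΩ⟩ := exists_compact_between hK Ω.isOpen hKΩ
  obtain ⟨M, hM, hLM, hMΩ⟩ := exists_compact_between hL Ω.isOpen hLΩ
  obtain ⟨f, hf, hfr, hfs, hft⟩ := exists_contMDiff_support_eq_eq_one_iff (n := ⊤)
    (modelWithCornersSelf ℝ (E n)) (isOpen_interior (s := M)) hL.isClosed hLM
  have hts : tsupport f ⊆ M := closure_minimal (hfs.subset.trans interior_subset) hM.isClosed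
  refine ⟨⟨f, hf.contDiff, hM.of_isClosed_subset (isClosed_tsupport f) hts, hts.trans hMΩ⟩,
    fun x hx => ?_, fun x => hfr ⟨x, rfl⟩⟩
  filter_upwards [mem_interior_iff_mem_nhds.1 (hKL hx)] with y hy using (hft y).1 hy

theorem continuous_gradient_test (φ : 𝓓(Ω, ℝ)) : Continuous (gradient (φ : E n → ℝ)) :=
  (InnerProductSpace.toDual ℝ (E n)).symm.continuous.comp (φ.contDiff.continuous_fderiv (by simp))

theorem differentiable_test (φ : 𝓓(Ω, ℝ)) : Differentiable ℝ (φ : E n → ℝ) :=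
  φ.contDiff.differentiable (by simp)

theorem gradient_eq_zero_of_notMem_tsupport {f : E n → ℝ} {x : E n} (hx : x ∉ tsupport f) :
    gradient f x = 0 := by
  simp [gradient, fderiv_of_notMem_tsupport ℝ hx]

theorem exists_bound_test (φ : 𝓓(Ω, ℝ)) : ∃ M, 0 ≤ M ∧ ∀ x, |φ x| ≤ M := by
  obtain ⟨C, hC⟩ := φ.continuous.bounded_above_of_compact_support φ.hasCompactSupport
  exact ⟨C, (norm_nonneg _).trans (hC 0), hC⟩

theorem exists_bound_gradient (φ : 𝓓(Ω, ℝ)) :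
    ∃ M, 0 ≤ M ∧ ∀ x, ‖gradient (φ : E n → ℝ) x‖ ≤ M := by
  have hc : HasCompactSupport (gradient (φ : E n → ℝ)) :=
    φ.hasCompactSupport.mono' fun x hx => by
      by_contra h
      exact hx (gradient_eq_zero_of_notMem_tsupport h)
  obtain ⟨C, hC⟩ := (continuous_gradient_test φ).bounded_above_of_compact_support hc
  exact ⟨C, (norm_nonneg _).trans (hC 0), hC⟩

/-! ### Integrability of products with test functions. -/

section Integrability

variable {F : Type*} [NormedAddCommGroup F]

/-- A locally integrable function times a bounded function with compact support in `Ω`. -/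
theorem integrableOn_of_norm_le_of_compact {F' : Type*} [NormedAddCommGroup F']
    {f : E n → F'} {g : E n → F} {K : Set (E n)} {M : ℝ}
    (hK : IsCompact K) (hKΩ : K ⊆ Ω) (hg : LocallyIntegrableOn g Ω)
    (hf : AEStronglyMeasurable f (volume.restrict Ω))
    (hfg : ∀ᵐ x ∂(volume.restrict (Ω : Set (E n))), ‖f x‖ ≤ M * ‖g x‖)
    (hf0 : ∀ x ∉ K, f x = 0) : IntegrableOn f Ω := by
  have hgK : IntegrableOn g K := hg.integrableOn_compact_subset hKΩ hK
  have h1 : Integrable (K.indicator fun x => M * ‖g x‖) (volume.restrict Ω) :=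
    ((integrable_indicator_iff hK.measurableSet).2 (hgK.norm.const_mul M)).restrict
  refine h1.mono' hf ?_
  filter_upwards [hfg] with x hx
  by_cases hxK : x ∈ K
  · simpa [hxK] using hx
  · simp [hxK, hf0 x hxK]

theorem integrableOn_test_smul [NormedSpace ℝ F] {g : E n → F} (hg : LocallyIntegrableOn g Ω) (φ : 𝓓(Ω, ℝ)) :
    IntegrableOn (fun x => φ x • g x) Ω := by
  obtain ⟨M, -, hM⟩ := exists_bound_test φ
  refine integrableOn_of_norm_le_of_compact (M := M) φ.hasCompactSupport φ.tsupport_subset hg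
    (φ.continuous.aestronglyMeasurable.smul hg.aestronglyMeasurable) (.of_forall fun x => ?_)
    fun x hx => by simp [image_eq_zero_of_notMem_tsupport hx]
  rw [norm_smul]
  exact mul_le_mul_of_nonneg_right (hM x) (norm_nonneg _)

theorem integrableOn_smul_gradient {u : E n → ℝ} (hu : LocallyIntegrableOn u Ω) (φ : 𝓓(Ω, ℝ)) :
    IntegrableOn (fun x => u x • gradient (φ : E n → ℝ) x) Ω := by
  obtain ⟨M, -, hM⟩ := exists_bound_gradient φ
  refine integrableOn_of_norm_le_of_compact (M := M) φ.hasCompactSupport φ.tsupport_subset hu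
    (hu.aestronglyMeasurable.smul (continuous_gradient_test φ).aestronglyMeasurable)
    (.of_forall fun x => ?_)
    fun x hx => by simp [gradient_eq_zero_of_notMem_tsupport hx]
  rw [norm_smul, mul_comm]
  exact mul_le_mul_of_nonneg_right (hM x) (norm_nonneg _)

end Integrability

/-! ### Calculus of weak gradients -/

/-- The fundamental lemma of the calculus of variations, applied to `G - G'`. -/
theorem HasWeakGrad.ae_unique {u : E n → ℝ} {G G' : E n → E n} (h : HasWeakGrad Ω u G)
    (h' : HasWeakGrad Ω u G') : G =ᵐ[volume.restrict (Ω : Set (E n))] G' := by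
  have := Ω.isOpen.ae_eq_zero_of_integral_contDiff_smul_eq_zero (μ := volume)
    (h.2.1.sub h'.2.1) (fun g hg hgc hgs => ?_)
  · filter_upwards [(ae_restrict_iff' Ω.isOpen.measurableSet).2 this] with x hx
    simpa [sub_eq_zero] using hx
  · let φ : 𝓓(Ω, ℝ) := ⟨g, hg, hgc, hgs⟩
    have e1 := h.2.2 φ
    rw [h'.2.2 φ, neg_inj] at e1
    rw [← setIntegral_eq_integral_of_forall_compl_eq_zero (s := (Ω : Set (E n)))
      fun x hx => by rw [image_eq_zero_of_notMem_tsupport fun hx' => hx (hgs hx'), zero_smul]]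
    simp only [Pi.sub_apply, smul_sub]
    exact (integral_sub (integrableOn_test_smul h.2.1 φ) (integrableOn_test_smul h'.2.1 φ)).trans
      (sub_eq_zero.2 e1.symm)

theorem weakGrad_spec {u : E n → ℝ} (h : ∃ G, HasWeakGrad Ω u G) :
    HasWeakGrad Ω u (weakGrad Ω u) := by
  rw [weakGrad, dif_pos h]
  exact h.choose_spec

theorem HasWeakGrad.weakGrad_ae_eq {u : E n → ℝ} {G : E n → E n} (h : HasWeakGrad Ω u G) :
    weakGrad Ω u =ᵐ[volume.restrict (Ω : Set (E n))] G :=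
  (weakGrad_spec ⟨G, h⟩).ae_unique h

theorem HasWeakGrad.add {u v : E n → ℝ} {G H : E n → E n} (hu : HasWeakGrad Ω u G)
    (hv : HasWeakGrad Ω v H) : HasWeakGrad Ω (u + v) (G + H) := by
  refine ⟨hu.1.add hv.1, hu.2.1.add hv.2.1, fun φ => ?_⟩
  simp only [Pi.add_apply, add_smul, smul_add]
  rw [integral_add (integrableOn_smul_gradient hu.1 φ) (integrableOn_smul_gradient hv.1 φ),
    integral_add (integrableOn_test_smul hu.2.1 φ) (integrableOn_test_smul hv.2.1 φ),
    hu.2.2 φ, hv.2.2 φ, neg_add]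

theorem HasWeakGrad.const_smul {u : E n → ℝ} {G : E n → E n} (c : ℝ) (hu : HasWeakGrad Ω u G) :
    HasWeakGrad Ω (c • u) (c • G) := by
  refine ⟨hu.1.smul c, hu.2.1.smul c, fun φ => ?_⟩
  simp only [Pi.smul_apply, smul_assoc, smul_comm _ c, integral_smul, hu.2.2 φ, smul_neg]

theorem HasWeakGrad.congr {u v : E n → ℝ} {G H : E n → E n} (hu : HasWeakGrad Ω u G)
    (h : u =ᵐ[volume.restrict (Ω : Set (E n))] v) (h' : G =ᵐ[volume.restrict (Ω : Set (E n))] H) :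
    HasWeakGrad Ω v H := by
  refine ⟨hu.1.congr h, hu.2.1.congr h', fun φ => ?_⟩
  rw [integral_congr_ae (g := fun x => u x • gradient (φ : E n → ℝ) x)
      (h.mono fun x hx => by simp only [hx]), hu.2.2 φ,
    integral_congr_ae (g := fun x => φ x • H x) (h'.mono fun x hx => by simp only [hx])]

theorem inner_integral_eq {f : E n → E n} (hf : IntegrableOn f Ω) (c : E n) :
    ⟪∫ x in Ω, f x, c⟫ = ∫ x in Ω, ⟪f x, c⟫ := by
  rw [real_inner_comm, ← integral_inner hf c]
  simp only [real_inner_comm]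

/-- Integration by parts for `C¹` functions, one of them compactly supported in `Ω`. -/
theorem setIntegral_smul_gradient {f : E n → ℝ} {f' : E n → E n} (hf : ∀ x, HasGradientAt f (f' x) x)
    (hf' : Continuous f') (φ : 𝓓(Ω, ℝ)) :
    ∫ x in Ω, f x • gradient (φ : E n → ℝ) x = -∫ x in Ω, φ x • f' x := by
  have hfc : Continuous f := continuous_iff_continuousAt.2 fun x => (hf x).continuousAt
  have hfl : LocallyIntegrableOn f Ω := hfc.locallyIntegrable.locallyIntegrableOn _
  have hfl' : LocallyIntegrableOn f' Ω := hf'.locallyIntegrable.locallyIntegrableOn _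
  -- Pairing with a fixed vector reduces the vector identity to scalar integration by parts for one
  -- directional derivative.
  refine ext_inner_right ℝ fun v => ?_
  rw [inner_neg_left, inner_integral_eq (integrableOn_smul_gradient hfl φ),
    inner_integral_eq (integrableOn_test_smul hfl' φ)]
  have hgradφ : ∀ x, ⟪gradient (φ : E n → ℝ) x, v⟫ = fderiv ℝ (φ : E n → ℝ) x v := fun x =>
    inner_gradient_left
  simp only [inner_smul_left, hgradφ, RCLike.conj_to_real]
  have hgrad : ∀ x, ⟪f' x, v⟫ = fderiv ℝ f x v := fun x => ((hf x).fderiv_apply).symm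
  simp only [hgrad]
  have hφc : HasCompactSupport (fun x => fderiv ℝ (φ : E n → ℝ) x v) :=
    (φ.hasCompactSupport.fderiv ℝ).comp_left (g := fun L : E n →L[ℝ] ℝ => L v) rfl
  have hφ' : Continuous (fun x => fderiv ℝ (φ : E n → ℝ) x v) :=
    (φ.contDiff.continuous_fderiv (by simp)).clm_apply continuous_const
  have hfd : Continuous (fun x => fderiv ℝ f x v) := by
    simp only [← hgrad]; fun_prop
  rw [setIntegral_eq_integral_of_forall_compl_eq_zero, setIntegral_eq_integral_of_forall_compl_eq_zero]
  · simp only [mul_comm (φ _)]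
    rw [integral_mul_fderiv_eq_neg_fderiv_mul_of_integrable]
    · exact (hfd.mul φ.continuous).integrable_of_hasCompactSupport φ.hasCompactSupport.mul_left
    · exact (hfc.mul hφ').integrable_of_hasCompactSupport hφc.mul_left
    · exact (hfc.mul φ.continuous).integrable_of_hasCompactSupport φ.hasCompactSupport.mul_left
    · exact fun x _ => (hf x).differentiableAt
    · exact fun x _ => differentiable_test φ x
  · intro x hx
    rw [image_eq_zero_of_notMem_tsupport fun hx' => hx (φ.tsupport_subset hx'), zero_mul]
  · intro x hx
    rw [fderiv_of_notMem_tsupport ℝ fun hx' => hx (φ.tsupport_subset hx')]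
    simp

theorem hasGradientAt_test (φ : 𝓓(Ω, ℝ)) (x : E n) :
    HasGradientAt (φ : E n → ℝ) (gradient (φ : E n → ℝ) x) x :=
  (differentiable_test φ x).hasGradientAt

theorem hasWeakGrad_test (φ : 𝓓(Ω, ℝ)) : HasWeakGrad Ω φ (gradient (φ : E n → ℝ)) :=
  ⟨φ.continuous.locallyIntegrable.locallyIntegrableOn _,
    (continuous_gradient_test φ).locallyIntegrable.locallyIntegrableOn _,
    setIntegral_smul_gradient (hasGradientAt_test φ) (continuous_gradient_test φ)⟩

theorem HasGradientAt.mul_real {f g : E n → ℝ} {f' g' x : E n} (hf : HasGradientAt f f' x)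
    (hg : HasGradientAt g g' x) :
    HasGradientAt (fun y => f y * g y) (f x • g' + g x • f') x := by
  rw [hasGradientAt_iff_hasFDerivAt] at *
  convert! hf.mul hg using 1
  simp

theorem gradient_mul_test {f : E n → ℝ} {x : E n} (hf : DifferentiableAt ℝ f x) (φ : 𝓓(Ω, ℝ)) :
    gradient (fun y => f y * φ y) x = f x • gradient (φ : E n → ℝ) x + φ x • gradient f x :=
  (HasGradientAt.mul_real hf.hasGradientAt (hasGradientAt_test φ x)).gradient

/-- The product of a smooth function and a test function. -/
noncomputable def smoothMul {f : E n → ℝ} (hf : ContDiff ℝ (⊤ : ℕ∞) f) (φ : 𝓓(Ω, ℝ)) : 𝓓(Ω, ℝ) where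
  toFun x := f x * φ x
  contDiff' := hf.mul φ.contDiff
  hasCompactSupport' := φ.hasCompactSupport.mul_left
  tsupport_subset' := (tsupport_mul_subset_right).trans φ.tsupport_subset

theorem smoothMul_apply {f : E n → ℝ} (hf : ContDiff ℝ (⊤ : ℕ∞) f) (φ : 𝓓(Ω, ℝ)) (x : E n) :
    smoothMul hf φ x = f x * φ x := rfl

/-- Test the weak gradient of `u` with `η φ`: the Leibniz rule for `∇(η φ)` produces the extra term
`φ u ∇η`, which is then moved to the other side. Multiplying by a cutoff is what makes mollification
inside `Ω` possible. -/
theorem HasWeakGrad.test_mul {u : E n → ℝ} {G : E n → E n} (hu : HasWeakGrad Ω u G)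
    (η : 𝓓(Ω, ℝ)) :
    HasWeakGrad Ω (fun x => η x * u x) (fun x => η x • G x + u x • gradient (η : E n → ℝ) x) := by
  have i1 : IntegrableOn (fun x => η x * u x) Ω := integrableOn_test_smul hu.1 η
  have i2 := (integrableOn_test_smul hu.2.1 η).add (integrableOn_smul_gradient hu.1 η)
  refine ⟨i1.locallyIntegrableOn, i2.locallyIntegrableOn, fun φ => ?_⟩
  have h1 := hu.2.2 (smoothMul η.contDiff φ)
  have hg : ∀ x, gradient (smoothMul η.contDiff φ : E n → ℝ) x =
      η x • gradient (φ : E n → ℝ) x + φ x • gradient (η : E n → ℝ) x := fun x =>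
    gradient_mul_test (differentiable_test η x) φ
  have j1 : IntegrableOn (fun x => (η x * u x) • gradient (φ : E n → ℝ) x) Ω :=
    integrableOn_smul_gradient i1.locallyIntegrableOn φ
  have j2 : IntegrableOn (fun x => φ x • u x • gradient (η : E n → ℝ) x) Ω :=
    integrableOn_test_smul (integrableOn_smul_gradient hu.1 η).locallyIntegrableOn φ
  have j3 : IntegrableOn (fun x => φ x • η x • G x) Ω :=
    integrableOn_test_smul (integrableOn_test_smul hu.2.1 η).locallyIntegrableOn φ
  simp only [hg, smoothMul_apply] at h1
  have e1 : ∀ x, u x • (η x • gradient (φ : E n → ℝ) x + φ x • gradient (η : E n → ℝ) x) =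
      (η x * u x) • gradient (φ : E n → ℝ) x + φ x • u x • gradient (η : E n → ℝ) x := fun x => by
    module
  have e2 : ∀ x, (η x * φ x) • G x = φ x • η x • G x := fun x => by module
  simp only [e1, e2] at h1
  rw [integral_add j1 j2] at h1
  simp only [smul_add]
  rw [integral_add j3 j2, neg_add, ← h1]
  abel

/-! ### Mollification -/

section Mollification

variable {F : Type*} [NormedAddCommGroup F] [NormedSpace ℝ F]

/-- Young's inequality for a kernel of mass one: pointwise `|ρ * f| ≤ ρ * |f|`, and the integral of
a convolution is the product of the integrals. -/
theorem integral_norm_mollify_le {f : E n → F} (hf : Integrable f)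
    (ρ : ContDiffBump (0 : E n)) :
    ∫ x, ‖(ρ.normed volume ⋆[lsmul ℝ ℝ, volume] f) x‖ ≤ ∫ x, ‖f x‖ := by
  have hρ : Integrable (ρ.normed volume) (volume : Measure (E n)) := ρ.integrable_normed
  have h1 := integral_convolution (L := lsmul ℝ ℝ) hρ hf.norm
  rw [ρ.integral_normed] at h1
  simp only [ContinuousLinearMap.lsmul_apply, smul_eq_mul, one_mul] at h1
  rw [← h1]
  refine integral_mono (hρ.integrable_convolution _ hf).norm
    (hρ.integrable_convolution _ hf.norm) fun x => ?_
  refine (norm_integral_le_integral_norm _).trans (le_of_eq ?_)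
  refine integral_congr_ae (.of_forall fun t => ?_)
  simp [norm_smul, abs_of_nonneg (ρ.nonneg_normed t)]

/-- Mollifications of an integrable function converge to it in `L¹`. -/
theorem exists_mollify_close [CompleteSpace F] {g : E n → F} (hg : Integrable g) {ε : ℝ} (hε : 0 < ε) :
    ∃ r, 0 < r ∧ ∀ ρ : ContDiffBump (0 : E n), ρ.rOut < r →
      ∫ x, ‖(ρ.normed volume ⋆[lsmul ℝ ℝ, volume] g) x - g x‖ ≤ ε := by
  -- A three-epsilon argument: `g` is replaced by a continuous compactly supported `h`, whose
  -- mollifications converge uniformly; the contraction property in `L¹` controls the mollification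
  -- of `g - h`.
  obtain ⟨h, hhc, hgh, hcont, hint⟩ :=
    hg.exists_hasCompactSupport_integral_sub_le (ε := ε / 3) (by positivity)
  set K := Metric.cthickening 1 (tsupport h) with hKdef
  have hK : IsCompact K := hhc.isCompact.cthickening
  -- For radii below `1`, both `h` and its mollification vanish off `K`, so a uniform error `c`
  -- costs at most `c |K| ≤ ε / 3`; the `+ 1` allows `|K| = 0`.
  set c := ε / 3 / (volume.real K + 1) with hc
  have hc0 : 0 < c := by positivity
  obtain ⟨δ, hδ, hδh⟩ := Metric.uniformContinuous_iff.1
    (hhc.uniformContinuous_of_continuous hcont) c hc0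
  refine ⟨min δ 1, by positivity, fun ρ hρr => ?_⟩
  have hρ : Integrable (ρ.normed volume) (volume : Measure (E n)) := ρ.integrable_normed
  set m : (E n → F) → E n → F := fun f => ρ.normed volume ⋆[lsmul ℝ ℝ, volume] f with hm
  have hb : ∀ x, ‖m h x - h x‖ ≤ K.indicator (fun _ => c) x := fun x => by
    rw [← dist_eq_norm]
    by_cases hx : x ∈ K
    · rw [indicator_of_mem hx]
      refine ContDiffBump.dist_normed_convolution_le hcont.aestronglyMeasurable fun y hy => ?_
      exact (hδh (lt_of_lt_of_le (Metric.mem_ball.1 hy) (hρr.le.trans (min_le_left _ _)))).le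
    · rw [indicator_of_notMem hx]
      have hz : ∀ y ∈ Metric.ball x ρ.rOut, h y = 0 := fun y hy => by
        by_contra hne
        refine hx (Metric.mem_cthickening_of_dist_le x y 1 _ (subset_tsupport h hne) ?_)
        rw [dist_comm]
        exact (Metric.mem_ball.1 hy).le.trans (hρr.le.trans (min_le_right _ _))
      refine ContDiffBump.dist_normed_convolution_le hcont.aestronglyMeasurable fun y hy => ?_
      rw [hz y hy, hz x (Metric.mem_ball_self ρ.rOut_pos), dist_self]
  have i1 : Integrable (fun x => ‖m h x - h x‖) :=
    ((hρ.integrable_convolution _ hint).sub hint).norm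
  have i2 : Integrable (fun x => ‖m (g - h) x‖) :=
    (hρ.integrable_convolution _ (hg.sub hint)).norm
  have i3 : Integrable (fun x => ‖g x - h x‖) := (hg.sub hint).norm
  have e1 : ∫ x, ‖m h x - h x‖ ≤ ε / 3 := by
    calc ∫ x, ‖m h x - h x‖ ≤ ∫ x, K.indicator (fun _ => c) x :=
          integral_mono i1 ((integrable_indicator_iff hK.measurableSet).2
            (integrableOn_const hK.measure_lt_top.ne)) hb
      _ = volume.real K * c := by
          rw [integral_indicator hK.measurableSet, setIntegral_const, smul_eq_mul]
      _ ≤ ε / 3 := by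
          rw [hc, ← mul_div_assoc, div_le_iff₀ (by positivity)]
          nlinarith [measureReal_nonneg (μ := volume) (s := K)]
  have e2 : ∫ x, ‖m (g - h) x‖ ≤ ε / 3 :=
    (integral_norm_mollify_le (hg.sub hint) ρ).trans hgh
  have hsplit : ∀ x, m g x = m h x + m (g - h) x := fun x => by
    have := ConvolutionExistsAt.distrib_add (L := lsmul ℝ ℝ) (μ := volume) (x := x)
      (f := ρ.normed volume) (g := h) (g' := g - h)
      (ρ.hasCompactSupport_normed.convolutionExists_left _ ρ.continuous_normed
        hint.locallyIntegrable x)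
      (ρ.hasCompactSupport_normed.convolutionExists_left _ ρ.continuous_normed
        (hg.sub hint).locallyIntegrable x)
    rw [add_sub_cancel] at this
    exact this
  calc ∫ x, ‖m g x - g x‖
      ≤ ∫ x, (‖m h x - h x‖ + ‖m (g - h) x‖ + ‖g x - h x‖) := by
        refine integral_mono ((hρ.integrable_convolution _ hg).sub hg).norm
          ((i1.add i2).add i3) fun x => ?_
        change ‖m g x - g x‖ ≤ ‖m h x - h x‖ + ‖m (g - h) x‖ + ‖g x - h x‖
        rw [hsplit x, show m h x + m (g - h) x - g x =
          (m h x - h x) + m (g - h) x - (g x - h x) by abel]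
        exact (norm_sub_le _ _).trans (add_le_add (norm_add_le _ _) le_rfl)
    _ = (∫ x, ‖m h x - h x‖) + (∫ x, ‖m (g - h) x‖) + ∫ x, ‖g x - h x‖ := by
        rw [← integral_add i1 i2]
        exact integral_add (i1.add i2) i3
    _ ≤ ε := by linarith

end Mollification

theorem gradient_comp_sub_left {f : E n → ℝ} (hf : Differentiable ℝ f) (x y : E n) :
    gradient (fun z => f (x - z)) y = -gradient f (x - y) := by
  have h : HasFDerivAt (fun z => f (x - z)) (-(fderiv ℝ f (x - y))) y := by
    have := (hf (x - y)).hasFDerivAt.comp y ((hasFDerivAt_id y).const_sub x)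
    convert! this using 1
    ext v; simp
  rw [gradient, h.fderiv, gradient, map_neg]

/-- A compactly supported Sobolev function is a limit of test functions in `W^{1,1}`. -/
theorem HasWeakGrad.exists_test_close {u : E n → ℝ} {G : E n → E n} (h : HasWeakGrad Ω u G)
    {K : Set (E n)} (hK : IsCompact K) (hKΩ : K ⊆ Ω)
    (hu : ∀ᵐ x ∂(volume.restrict (Ω : Set (E n))), x ∉ K → u x = 0)
    (hG : ∀ᵐ x ∂(volume.restrict (Ω : Set (E n))), x ∉ K → G x = 0) {ε : ℝ} (hε : 0 < ε) :
    ∃ φ : 𝓓(Ω, ℝ), ∫ x in Ω, |u x - φ x| ≤ ε ∧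
      ∫ x in Ω, ‖G x - gradient (φ : E n → ℝ) x‖ ≤ ε := by
  set u0 := K.indicator u with hu0
  set G0 := K.indicator G with hG0
  have iu : Integrable u0 := (integrable_indicator_iff hK.measurableSet).2
    (h.1.integrableOn_compact_subset hKΩ hK)
  have iG : Integrable G0 := (integrable_indicator_iff hK.measurableSet).2
    (h.2.1.integrableOn_compact_subset hKΩ hK)
  have eu : ∀ᵐ x ∂(volume.restrict (Ω : Set (E n))), u x = u0 x := by
    filter_upwards [hu] with x hx
    by_cases hxK : x ∈ K
    · simp [hu0, hxK]
    · simp [hu0, hxK, hx hxK]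
  have eG : ∀ᵐ x ∂(volume.restrict (Ω : Set (E n))), G x = G0 x := by
    filter_upwards [hG] with x hx
    by_cases hxK : x ∈ K
    · simp [hG0, hxK]
    · simp [hG0, hxK, hx hxK]
  obtain ⟨δ, hδ, hδΩ⟩ := hK.exists_cthickening_subset_open Ω.isOpen hKΩ
  obtain ⟨r1, hr1, H1⟩ := exists_mollify_close iu hε
  obtain ⟨r2, hr2, H2⟩ := exists_mollify_close iG hε
  set r := min δ (min r1 r2) / 2 with hr
  have hm : 0 < min δ (min r1 r2) := by positivity
  let ρ : ContDiffBump (0 : E n) := ⟨r / 2, r, by positivity, by linarith [half_pos hm]⟩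
  have hρr : ρ.rOut < min δ (min r1 r2) := half_lt_self hm
  have hρδ : ρ.rOut < δ := hρr.trans_le (min_le_left _ _)
  specialize H1 ρ (hρr.trans_le ((min_le_right _ _).trans (min_le_left _ _)))
  specialize H2 ρ (hρr.trans_le ((min_le_right _ _).trans (min_le_right _ _)))
  set k := ρ.normed (volume : Measure (E n)) with hk
  have hkd : ContDiff ℝ (⊤ : ℕ∞) k := ρ.contDiff_normed
  have hkc : HasCompactSupport k := ρ.hasCompactSupport_normed
  set φ := k ⋆[lsmul ℝ ℝ, volume] u0 with hφ
  have hφd : ContDiff ℝ (⊤ : ℕ∞) φ :=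
    hkc.contDiff_convolution_left _ hkd iu.locallyIntegrable
  have hsupp : tsupport φ ⊆ Metric.cthickening δ K := by
    refine closure_minimal ?_ Metric.isClosed_cthickening
    refine (support_convolution_subset _).trans ?_
    rintro _ ⟨a, ha, b, hb, rfl⟩
    rw [hk, ρ.support_normed_eq, mem_ball_zero_iff] at ha
    refine Metric.mem_cthickening_of_dist_le _ b δ K (support_indicator_subset hb) ?_
    simpa using (ha.trans hρδ).le
  let φ' : 𝓓(Ω, ℝ) := ⟨φ, hφd, hK.cthickening.of_isClosed_subset (isClosed_tsupport _) hsupp,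
    hsupp.trans hδΩ⟩
  -- The gradient of the mollification is the mollification of the weak gradient. The derivative
  -- falls on the kernel `k (x - ·)`, and the weak formulation moves it to `u`. The cutoff `η` makes
  -- the kernel an admissible test function; being `1` near `K`, it changes neither the kernel nor
  -- its gradient where `u` and `G` live.
  have hgrad : ∀ x, gradient φ x = (k ⋆[lsmul ℝ ℝ, volume] G0) x := fun x => by
    obtain ⟨η, hη1, -⟩ := exists_cutoff hK hKΩ
    have hkx : ContDiff ℝ (⊤ : ℕ∞) (fun y => k (x - y)) := by fun_prop
    have htest := h.2.2 (smoothMul hkx η)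
    have hηK : ∀ y ∈ K, η y = 1 := fun y hy => (hη1 y hy).self_of_nhds
    have hg' : ∀ y ∈ K, gradient (smoothMul hkx η : E n → ℝ) y = -gradient k (x - y) := by
      intro y hy
      have : (smoothMul hkx η : E n → ℝ) =ᶠ[𝓝 y] fun z => k (x - z) := by
        filter_upwards [hη1 y hy] with z hz
        rw [smoothMul_apply, hz, mul_one]
      rw [this.gradient_eq, gradient_comp_sub_left (hkd.differentiable (by simp))]
    refine ext_inner_right ℝ fun v => ?_
    have e1 : ⟪gradient φ x, v⟫ = ∫ y, ⟪u0 y • gradient k (x - y), v⟫ := by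
      have hd := hkc.hasFDerivAt_convolution_left (lsmul ℝ ℝ) (hkd.of_le (by simp))
        iu.locallyIntegrable x
      have : ⟪gradient φ x, v⟫ = fderiv ℝ φ x v := inner_gradient_left
      rw [this, hφ, hd.fderiv, convolution_eq_swap]
      have hex : Integrable (fun t => (((lsmul ℝ ℝ).precompL (E n) :
          (E n →L[ℝ] ℝ) →L[ℝ] ℝ →L[ℝ] (E n →L[ℝ] ℝ)) (fderiv ℝ k (x - t))) (u0 t)) := by
        have := (hkc.fderiv ℝ).convolutionExists_left ((lsmul ℝ ℝ).precompL (E n) :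
          (E n →L[ℝ] ℝ) →L[ℝ] ℝ →L[ℝ] (E n →L[ℝ] ℝ)) (hkd.continuous_fderiv (by simp))
          iu.locallyIntegrable x
        exact this.integrable_swap
      rw [ContinuousLinearMap.integral_apply hex]
      refine integral_congr_ae (.of_forall fun y => ?_)
      have h2 : ⟪gradient k (x - y), v⟫ = fderiv ℝ k (x - y) v := inner_gradient_left
      simp [ContinuousLinearMap.precompL_apply, inner_smul_left, h2, mul_comm]
    have iuk : Integrable (fun y => u0 y • gradient k (x - y)) := by
      have hgc : Continuous (gradient k) := (InnerProductSpace.toDual ℝ (E n)).symm.continuous.comp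
        (hkd.continuous_fderiv (by simp))
      have hgc' : HasCompactSupport (gradient k) := hkc.mono' fun z hz => by
        by_contra hz'
        exact hz (gradient_eq_zero_of_notMem_tsupport hz')
      obtain ⟨M, hM⟩ := hgc.bounded_above_of_compact_support hgc'
      refine (iu.norm.const_mul M).mono' (iu.1.smul
        (hgc.comp (continuous_const.sub continuous_id)).aestronglyMeasurable)
        (.of_forall fun y => ?_)
      rw [norm_smul, mul_comm]
      exact mul_le_mul_of_nonneg_right (hM _) (norm_nonneg _)
    have e2 : ∫ y, u0 y • gradient k (x - y) =
        -∫ y in Ω, u y • gradient (smoothMul hkx η : E n → ℝ) y := by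
      rw [← integral_neg, ← setIntegral_eq_integral_of_forall_compl_eq_zero (s := (Ω : Set (E n)))]
      · refine integral_congr_ae ?_
        filter_upwards [hu] with y hy
        by_cases hyK : y ∈ K
        · simp [hu0, hyK, hg' y hyK]
        · simp [hu0, hyK, hy hyK]
      · intro y hy
        have hyK : y ∉ K := fun hyK => hy (hKΩ hyK)
        simp [hu0, hyK]
    have e3 : ∫ y in Ω, smoothMul hkx η y • G y = (k ⋆[lsmul ℝ ℝ, volume] G0) x := by
      rw [convolution_eq_swap, ← setIntegral_eq_integral_of_forall_compl_eq_zero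
        (s := (Ω : Set (E n))) (f := fun t => lsmul ℝ ℝ (k (x - t)) (G0 t))]
      · refine integral_congr_ae ?_
        filter_upwards [hG] with y hy
        by_cases hyK : y ∈ K
        · simp [hG0, hyK, smoothMul_apply, hηK y hyK]
        · simp [hG0, hyK, hy hyK]
      · intro y hy
        have hyK : y ∉ K := fun hyK => hy (hKΩ hyK)
        simp [hG0, hyK]
    have e4 : ∫ y, ⟪u0 y • gradient k (x - y), v⟫ = ⟪∫ y, u0 y • gradient k (x - y), v⟫ := by
      rw [real_inner_comm, ← integral_inner iuk v]
      simp only [real_inner_comm]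
    rw [e1, e4, e2, htest, neg_neg, e3]
  refine ⟨φ', ?_, ?_⟩
  · calc ∫ x in Ω, |u x - φ x| = ∫ x in Ω, ‖φ x - u0 x‖ := by
          refine integral_congr_ae ?_
          filter_upwards [eu] with x hx
          rw [hx, abs_sub_comm, Real.norm_eq_abs]
      _ ≤ ∫ x, ‖φ x - u0 x‖ := setIntegral_le_integral
          ((ρ.integrable_normed.integrable_convolution _ iu).sub iu).norm
          (.of_forall fun x => norm_nonneg _)
      _ ≤ ε := H1
  · calc ∫ x in Ω, ‖G x - gradient φ x‖ = ∫ x in Ω, ‖(k ⋆[lsmul ℝ ℝ, volume] G0) x - G0 x‖ := by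
          refine integral_congr_ae ?_
          filter_upwards [eG] with x hx
          rw [hx, hgrad, norm_sub_rev]
      _ ≤ ∫ x, ‖(k ⋆[lsmul ℝ ℝ, volume] G0) x - G0 x‖ := setIntegral_le_integral
          ((ρ.integrable_normed.integrable_convolution _ iG).sub iG).norm
          (.of_forall fun x => norm_nonneg _)
      _ ≤ ε := H2

theorem integrableOn_test (φ : 𝓓(Ω, ℝ)) : IntegrableOn (φ : E n → ℝ) Ω :=
  (φ.continuous.integrable_of_hasCompactSupport φ.hasCompactSupport).integrableOn

theorem integrableOn_gradient_test (φ : 𝓓(Ω, ℝ)) : IntegrableOn (gradient (φ : E n → ℝ)) Ω := by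
  have hc : HasCompactSupport (gradient (φ : E n → ℝ)) := φ.hasCompactSupport.mono' fun x hx => by
    by_contra h
    exact hx (gradient_eq_zero_of_notMem_tsupport h)
  exact ((continuous_gradient_test φ).integrable_of_hasCompactSupport hc).integrableOn

/-! ### The chain rule -/

theorem tendsto_integral_of_integral_norm_sub {X F : Type*} [MeasurableSpace X] {μ : Measure X}
    [NormedAddCommGroup F] [NormedSpace ℝ F] {ι : Type*} {l : Filter ι} {f : ι → X → F} {g : X → F}
    (hf : ∀ i, Integrable (f i) μ) (hg : Integrable g μ)
    (h : Tendsto (fun i => ∫ x, ‖f i x - g x‖ ∂μ) l (𝓝 0)) :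
    Tendsto (fun i => ∫ x, f i x ∂μ) l (𝓝 (∫ x, g x ∂μ)) := by
  rw [tendsto_iff_norm_sub_tendsto_zero]
  refine squeeze_zero (fun _ => norm_nonneg _) (fun i => ?_) h
  rw [← integral_sub (hf i) hg]
  exact norm_integral_le_integral_norm _

theorem exists_subseq_ae_tendsto_of_integral {X : Type*} [MeasurableSpace X] {μ : Measure X}
    {f : ℕ → X → ℝ} {g : X → ℝ} (hf : ∀ i, Integrable (f i) μ) (hg : Integrable g μ)
    (h : Tendsto (fun i => ∫ x, |g x - f i x| ∂μ) atTop (𝓝 0)) :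
    ∃ ns : ℕ → ℕ, StrictMono ns ∧
      ∀ᵐ x ∂μ, Tendsto (fun i => f (ns i) x) atTop (𝓝 (g x)) := by
  have h1 : Tendsto (fun i => eLpNorm (f i - g) 1 μ) atTop (𝓝 0) := by
    have := (ENNReal.continuous_ofReal.tendsto 0).comp h
    rw [ENNReal.ofReal_zero] at this
    refine this.congr fun i => ?_
    rw [eLpNorm_one_eq_lintegral_enorm, ← ofReal_integral_norm_eq_lintegral_enorm ((hf i).sub hg)]
    simp only [Function.comp, Pi.sub_apply, Real.norm_eq_abs, abs_sub_comm]
  exact (tendstoInMeasure_of_tendsto_eLpNorm one_ne_zero (fun i => (hf i).1) hg.1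
    h1).exists_seq_tendsto_ae

theorem locallyIntegrableOn_mono {F F' : Type*} [NormedAddCommGroup F] [NormedAddCommGroup F']
    {f : E n → F} {g : E n → F'} (hg : LocallyIntegrableOn g Ω)
    (hf : AEStronglyMeasurable f (volume.restrict Ω)) (h : ∀ x, ‖f x‖ ≤ ‖g x‖) :
    LocallyIntegrableOn f Ω := by
  rw [locallyIntegrableOn_iff Ω.isOpen.isLocallyClosed]
  intro K hKΩ hK
  exact (hg.integrableOn_compact_subset hKΩ hK).norm.mono'
    (hf.mono_measure (Measure.restrict_mono hKΩ le_rfl)) (.of_forall h)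

/-- The chain rule for a `C¹` function with bounded derivative. -/
theorem HasWeakGrad.comp_of_deriv_le {w : E n → ℝ} {G : E n → E n} (hw : HasWeakGrad Ω w G)
    {F F' : ℝ → ℝ} (hF : ∀ t, HasDerivAt F (F' t) t) (hF' : Continuous F') (hb : ∀ t, |F' t| ≤ 1) :
    HasWeakGrad Ω (fun x => F (w x)) (fun x => F' (w x) • G x) := by
  have hFc : Continuous F := continuous_iff_continuousAt.2 fun t => (hF t).continuousAt
  have hlip : ∀ a b, |F a - F b| ≤ |a - b| := fun a b => by
    have := Convex.norm_image_sub_le_of_norm_hasDerivWithin_le (C := 1)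
      (fun x _ => (hF x).hasDerivWithinAt) (fun x _ => hb x) convex_univ (mem_univ b) (mem_univ a)
    simpa using this
  have hmF : AEStronglyMeasurable (fun x => F (w x)) (volume.restrict Ω) :=
    hFc.comp_aestronglyMeasurable hw.1.aestronglyMeasurable
  have hmF' : AEStronglyMeasurable (fun x => F' (w x)) (volume.restrict Ω) :=
    hF'.comp_aestronglyMeasurable hw.1.aestronglyMeasurable
  have hl1 : LocallyIntegrableOn (fun x => F (w x)) Ω := by
    have : LocallyIntegrableOn (fun x => |w x| + |F 0|) Ω :=
      hw.1.norm.add (locallyIntegrableOn_const _)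
    refine locallyIntegrableOn_mono this hmF fun x => ?_
    have h1 := hlip (w x) 0
    rw [sub_zero] at h1
    rw [Real.norm_eq_abs, Real.norm_eq_abs, abs_of_nonneg (a := _ + _) (by positivity)]
    have h2 := abs_sub_abs_le_abs_sub (F (w x)) (F 0)
    linarith
  have hl2 : LocallyIntegrableOn (fun x => F' (w x) • G x) Ω :=
    locallyIntegrableOn_mono hw.2.1 (hmF'.smul hw.2.1.aestronglyMeasurable) fun x => by
      rw [norm_smul]
      exact mul_le_of_le_one_left (norm_nonneg _) (hb _)
  refine ⟨hl1, hl2, fun ζ => ?_⟩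
  -- Only values near the support of `ζ` matter, so `w` may be replaced by the compactly supported
  -- `η w`, which test functions approximate in `W^{1,1}`; the classical chain rule for these then
  -- passes to the limit.
  obtain ⟨η, hη, -⟩ := exists_cutoff ζ.hasCompactSupport ζ.tsupport_subset
  have hw1 := hw.test_mul η
  set w1 : E n → ℝ := fun x => η x * w x with hw1def
  set G1 : E n → E n := fun x => η x • G x + w x • gradient (η : E n → ℝ) x with hG1def
  have iw1 : IntegrableOn w1 Ω := integrableOn_test_smul hw.1 η
  have iG1 : IntegrableOn G1 Ω :=
    (integrableOn_test_smul hw.2.1 η).add (integrableOn_smul_gradient hw.1 η)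
  have happ := fun k : ℕ => hw1.exists_test_close η.hasCompactSupport η.tsupport_subset
    (.of_forall fun x hx => by simp [hw1def, image_eq_zero_of_notMem_tsupport hx])
    (.of_forall fun x hx => by
      simp [hG1def, image_eq_zero_of_notMem_tsupport hx, gradient_eq_zero_of_notMem_tsupport hx])
    (ε := 1 / ((k : ℝ) + 1)) (by positivity)
  choose φ hφ1 hφ2 using happ
  have t1 : Tendsto (fun k => ∫ x in Ω, |w1 x - φ k x|) atTop (𝓝 0) :=
    squeeze_zero (fun k => integral_nonneg fun x => abs_nonneg _) hφ1
      tendsto_one_div_add_atTop_nhds_zero_nat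
  have t2 : Tendsto (fun k => ∫ x in Ω, ‖G1 x - gradient (φ k : E n → ℝ) x‖) atTop (𝓝 0) :=
    squeeze_zero (fun k => integral_nonneg fun x => norm_nonneg _) hφ2
      tendsto_one_div_add_atTop_nhds_zero_nat
  have iφ : ∀ k, IntegrableOn (φ k : E n → ℝ) Ω := fun k =>
    ((φ k).continuous.integrable_of_hasCompactSupport (φ k).hasCompactSupport).integrableOn
  have igφ : ∀ k, IntegrableOn (gradient (φ k : E n → ℝ)) Ω := fun k =>
    integrableOn_gradient_test (φ k)
  obtain ⟨ns, hns, hae⟩ := exists_subseq_ae_tendsto_of_integral iφ iw1 t1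
  replace t1 := t1.comp hns.tendsto_atTop
  replace t2 := t2.comp hns.tendsto_atTop
  set χ : ℕ → 𝓓(Ω, ℝ) := fun i => φ (ns i) with hχ
  obtain ⟨M, hM0, hM⟩ := exists_bound_test ζ
  obtain ⟨M', hM0', hM'⟩ := exists_bound_gradient ζ
  have hgc : ∀ i x, HasGradientAt (fun y => F (χ i y))
      (F' (χ i x) • gradient (χ i : E n → ℝ) x) x := fun i x => by
    have := (hF (χ i x)).comp_hasFDerivAt x (differentiable_test (χ i) x).hasFDerivAt
    rw [hasGradientAt_iff_hasFDerivAt]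
    convert! this using 1
    simp [gradient]
  have hparts : ∀ i, ∫ x in Ω, F (χ i x) • gradient (ζ : E n → ℝ) x =
      -∫ x in Ω, ζ x • F' (χ i x) • gradient (χ i : E n → ℝ) x := fun i =>
    setIntegral_smul_gradient (hgc i)
      ((hF'.comp (χ i).continuous).smul (continuous_gradient_test _)) ζ
  have iζ : ∀ {f : E n → ℝ}, IntegrableOn f Ω →
      IntegrableOn (fun x => F (f x) • gradient (ζ : E n → ℝ) x) Ω := fun {f} hf => by
    refine integrableOn_smul_gradient ?_ ζ
    have : LocallyIntegrableOn (fun x => |f x| + |F 0|) Ω :=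
      hf.locallyIntegrableOn.norm.add (locallyIntegrableOn_const _)
    refine locallyIntegrableOn_mono this (hFc.comp_aestronglyMeasurable hf.1) fun x => ?_
    have h1 := hlip (f x) 0
    rw [sub_zero] at h1
    rw [Real.norm_eq_abs, Real.norm_eq_abs, abs_of_nonneg (a := _ + _) (by positivity)]
    have h2 := abs_sub_abs_le_abs_sub (F (f x)) (F 0)
    linarith
  have iζ' : ∀ {f : E n → ℝ} {H : E n → E n}, IntegrableOn f Ω → IntegrableOn H Ω →
      IntegrableOn (fun x => ζ x • F' (f x) • H x) Ω := fun {f H} hf hH => by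
    have hI : IntegrableOn (fun x => F' (f x) • H x) Ω volume := by
      refine hH.norm.mono' ((hF'.comp_aestronglyMeasurable hf.1).smul hH.1) (.of_forall fun x => ?_)
      rw [norm_smul]
      exact mul_le_of_le_one_left (norm_nonneg _) (hb _)
    exact integrableOn_test_smul hI.locallyIntegrableOn ζ
  have L1 : Tendsto (fun i => ∫ x in Ω, F (χ i x) • gradient (ζ : E n → ℝ) x) atTop
      (𝓝 (∫ x in Ω, F (w1 x) • gradient (ζ : E n → ℝ) x)) := by
    refine tendsto_integral_of_integral_norm_sub (fun i => iζ (iφ _)) (iζ iw1) ?_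
    refine squeeze_zero (fun i => integral_nonneg fun x => norm_nonneg _) (fun i => ?_)
      (by simpa only [mul_zero, Function.comp_def] using t1.const_mul M')
    rw [← integral_const_mul]
    refine integral_mono ((iζ (iφ _)).sub (iζ iw1)).norm
      ((iw1.sub (iφ _)).abs.const_mul _) fun x => ?_
    change ‖F (χ i x) • gradient (ζ : E n → ℝ) x - F (w1 x) • gradient (ζ : E n → ℝ) x‖ ≤
      M' * |w1 x - χ i x|
    rw [← sub_smul, norm_smul, mul_comm, Real.norm_eq_abs, abs_sub_comm (w1 x)]
    exact mul_le_mul (hM' x) (hlip _ _) (abs_nonneg _) hM0'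
  -- Split `F'(χ i) ∇χ i = F'(χ i) G1 + F'(χ i) (∇χ i - G1)`. The first term converges by domination
  -- along the a.e. convergent subsequence, the second is small in `L¹` since `|F'| ≤ 1`.
  have L2 : Tendsto (fun i => ∫ x in Ω, ζ x • F' (χ i x) • gradient (χ i : E n → ℝ) x) atTop
      (𝓝 (∫ x in Ω, ζ x • F' (w1 x) • G1 x)) := by
    have a1 : Tendsto (fun i => ∫ x in Ω, ζ x • F' (χ i x) • G1 x) atTop
        (𝓝 (∫ x in Ω, ζ x • F' (w1 x) • G1 x)) := by
      refine tendsto_integral_of_dominated_convergence (fun x => M * ‖G1 x‖)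
        (fun i => (iζ' (iφ _) iG1).1) (iG1.norm.const_mul _) (fun i => .of_forall fun x => ?_) ?_
      · rw [norm_smul, norm_smul]
        exact mul_le_mul (hM x) (mul_le_of_le_one_left (norm_nonneg _) (hb _)) (by positivity) hM0
      · filter_upwards [hae] with x hx
        exact (((hF'.tendsto _).comp hx).smul_const _).const_smul _
    have a2 : Tendsto (fun i => ∫ x in Ω, ζ x • F' (χ i x) • (gradient (χ i : E n → ℝ) x - G1 x))
        atTop (𝓝 0) := by
      refine squeeze_zero_norm (fun i => ?_) (by simpa only [mul_zero, Function.comp_def] using t2.const_mul M)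
      refine (norm_integral_le_integral_norm _).trans ?_
      rw [← integral_const_mul]
      refine integral_mono (iζ' (iφ _) ((igφ _).sub iG1)).norm
        ((iG1.sub (igφ _)).norm.const_mul _) fun x => ?_
      change ‖ζ x • F' (χ i x) • (gradient (χ i : E n → ℝ) x - G1 x)‖ ≤
        M * ‖G1 x - gradient (χ i : E n → ℝ) x‖
      rw [norm_smul, norm_smul, norm_sub_rev]
      exact mul_le_mul (hM x) (mul_le_of_le_one_left (norm_nonneg _) (hb _)) (by positivity) hM0
    have := a1.add a2
    rw [add_zero] at this
    refine this.congr fun i => ?_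
    refine (integral_add (iζ' (iφ _) iG1) (iζ' (iφ _) ((igφ _).sub iG1))).symm.trans
      (integral_congr_ae (.of_forall fun x => ?_))
    simp only [Pi.sub_apply, ← smul_add, add_sub_cancel, hχ]
  have hlim := tendsto_nhds_unique (L1.congr hparts) L2.neg
  have c1 : ∀ x, F (w x) • gradient (ζ : E n → ℝ) x = F (w1 x) • gradient (ζ : E n → ℝ) x := by
    intro x
    by_cases hx : x ∈ tsupport ζ
    · simp [hw1def, (hη x hx).self_of_nhds]
    · simp [gradient_eq_zero_of_notMem_tsupport hx]
  have c2 : ∀ x, ζ x • F' (w x) • G x = ζ x • F' (w1 x) • G1 x := by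
    intro x
    by_cases hx : x ∈ tsupport ζ
    · have hg : gradient (η : E n → ℝ) x = 0 := by
        have : (η : E n → ℝ) =ᶠ[𝓝 x] fun _ => 1 := hη x hx
        rw [this.gradient_eq, gradient_fun_const]
      simp [hw1def, hG1def, (hη x hx).self_of_nhds, hg]
    · simp [image_eq_zero_of_notMem_tsupport hx]
  simp only [c1, c2, hlim]

/-- Limit of the chain rule for the smooth functions `√(t² + τ²)` as `τ → 0`. Their derivatives `t /
√(t² + τ²)` are bounded by `1` and vanish at `t = 0`; the convention `0 / 0 = 0` makes `t / |t|`
their pointwise limit there too. -/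
theorem HasWeakGrad.abs {w : E n → ℝ} {G : E n → E n} (hw : HasWeakGrad Ω w G) :
    HasWeakGrad Ω (fun x => |w x|) (fun x => (w x / |w x|) • G x) := by
  have hm : AEStronglyMeasurable (fun x => w x / |w x|) (volume.restrict Ω) :=
    (hw.1.aestronglyMeasurable.aemeasurable.div
      hw.1.aestronglyMeasurable.aemeasurable.norm).aestronglyMeasurable
  have hdiv : ∀ t s : ℝ, |t| ≤ s → |t / s| ≤ 1 := fun t s hs => by
    have hs0 := (abs_nonneg t).trans hs
    rw [abs_div, abs_of_nonneg hs0]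
    exact div_le_one_of_le₀ hs hs0
  refine ⟨hw.1.norm, locallyIntegrableOn_mono hw.2.1 (hm.smul hw.2.1.aestronglyMeasurable)
    fun x => ?_, fun ζ => ?_⟩
  · rw [norm_smul]
    exact mul_le_of_le_one_left (norm_nonneg _) (hdiv _ _ le_rfl)
  set τ : ℕ → ℝ := fun k => 1 / ((k : ℝ) + 1) with hτ
  have hτ0 : ∀ k, 0 < τ k := fun k => by positivity
  have hτ1 : ∀ k, τ k ≤ 1 := fun k => by
    rw [hτ, div_le_one (by positivity)]; linarith [Nat.cast_nonneg (α := ℝ) k]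
  have hτt : Tendsto τ atTop (𝓝 0) := tendsto_one_div_add_atTop_nhds_zero_nat
  have hpos : ∀ k t, 0 < t ^ 2 + τ k ^ 2 := fun k t => by have := hτ0 k; positivity
  have hsq : ∀ k t, |t| ≤ √(t ^ 2 + τ k ^ 2) := fun k t => by
    rw [← Real.sqrt_sq_eq_abs]
    exact Real.sqrt_le_sqrt (by have := hτ0 k; nlinarith)
  have hd : ∀ k t, HasDerivAt (fun t : ℝ => √(t ^ 2 + τ k ^ 2)) (t / √(t ^ 2 + τ k ^ 2)) t := by
    intro k t
    have := ((hasDerivAt_pow 2 t).add_const (τ k ^ 2)).sqrt (hpos k t).ne'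
    convert! this using 1
    have := Real.sqrt_pos.2 (hpos k t)
    field_simp
    norm_num
    ring
  have hcc : ∀ k, Continuous fun t : ℝ => t / √(t ^ 2 + τ k ^ 2) := fun k =>
    continuous_id.div (by fun_prop) fun t => (Real.sqrt_pos.2 (hpos k t)).ne'
  have hk := fun k => (hw.comp_of_deriv_le (hd k) (hcc k) fun t => hdiv _ _ (hsq k t))
  have hpt : ∀ t : ℝ, Tendsto (fun k => √(t ^ 2 + τ k ^ 2)) atTop (𝓝 |t|) := fun t => by
    have : Tendsto (fun k => √(t ^ 2 + τ k ^ 2)) atTop (𝓝 √(t ^ 2 + 0 ^ 2)) :=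
      (Real.continuous_sqrt.tendsto _).comp ((hτt.pow 2).const_add _)
    simpa [Real.sqrt_sq_eq_abs] using this
  have hub : ∀ k t, √(t ^ 2 + τ k ^ 2) ≤ |t| + 1 := fun k t => by
    rw [Real.sqrt_le_left (by positivity)]
    have h1 := hτ1 k
    have h2 := hτ0 k
    nlinarith [sq_abs t, abs_nonneg t]
  have L1 : Tendsto (fun k => ∫ x in Ω, √(w x ^ 2 + τ k ^ 2) • gradient (ζ : E n → ℝ) x) atTop
      (𝓝 (∫ x in Ω, |w x| • gradient (ζ : E n → ℝ) x)) := by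
    have hloc : LocallyIntegrableOn (fun x => |w x| + 1) Ω :=
      hw.1.norm.add (locallyIntegrableOn_const _)
    refine tendsto_integral_of_dominated_convergence
      (fun x => ‖(|w x| + 1) • gradient (ζ : E n → ℝ) x‖)
      (fun k => (integrableOn_smul_gradient (hk k).1 ζ).1)
      (integrableOn_smul_gradient hloc ζ).norm (fun k => .of_forall fun x => ?_)
      (.of_forall fun x => (hpt _).smul_const _)
    rw [norm_smul, norm_smul, Real.norm_of_nonneg (Real.sqrt_nonneg _),
      Real.norm_of_nonneg (by positivity)]
    exact mul_le_mul_of_nonneg_right (hub _ _) (norm_nonneg _)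
  have L2 : Tendsto (fun k => ∫ x in Ω, ζ x • (w x / √(w x ^ 2 + τ k ^ 2)) • G x) atTop
      (𝓝 (∫ x in Ω, ζ x • (w x / |w x|) • G x)) := by
    refine tendsto_integral_of_dominated_convergence (fun x => ‖ζ x • G x‖)
      (fun k => (integrableOn_test_smul (hk k).2.1 ζ).1)
      (integrableOn_test_smul hw.2.1 ζ).norm (fun k => .of_forall fun x => ?_)
      (.of_forall fun x => ?_)
    · rw [norm_smul, norm_smul, norm_smul]
      exact mul_le_mul_of_nonneg_left
        (mul_le_of_le_one_left (norm_nonneg _) (hdiv _ _ (hsq k _))) (norm_nonneg _)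
    · rcases eq_or_ne (w x) 0 with h0 | h0
      · simp [h0]
      · exact ((tendsto_const_nhds.div (hpt _) (abs_ne_zero.2 h0)).smul_const _).const_smul _
  exact tendsto_nhds_unique (L1.congr fun k => (hk k).2.2 ζ) L2.neg

/-- Since `w = |w|`, both `G` and `(w / |w|) G` are weak gradients of `w`. The second is zero where
`w = 0`, and weak gradients are unique a.e. Applied to `u - ψ`, this identifies the two gradients on
the contact set. -/
theorem HasWeakGrad.ae_eq_zero_of_nonneg {w : E n → ℝ} {G : E n → E n} (hw : HasWeakGrad Ω w G)
    (h0 : ∀ᵐ x ∂(volume.restrict (Ω : Set (E n))), 0 ≤ w x) :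
    ∀ᵐ x ∂(volume.restrict (Ω : Set (E n))), w x = 0 → G x = 0 := by
  have h1 : HasWeakGrad Ω w fun x => (w x / |w x|) • G x :=
    hw.abs.congr (h0.mono fun x hx => abs_of_nonneg hx) (ae_eq_refl _)
  filter_upwards [hw.ae_unique h1] with x hx h
  simpa [h] using hx

/-- A version of the Heaviside function, with the value `1/2` at `0`. -/
noncomputable def step (t : ℝ) : ℝ := (1 + t / |t|) / 2

theorem step_of_pos {t : ℝ} (ht : 0 < t) : step t = 1 := by
  rw [step, abs_of_pos ht, div_self ht.ne']; norm_num

theorem step_of_neg {t : ℝ} (ht : t < 0) : step t = 0 := by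
  rw [step, abs_of_neg ht, div_neg, div_self ht.ne]; norm_num

theorem step_mem_Icc (t : ℝ) : step t ∈ Icc (0 : ℝ) 1 := by
  rcases lt_trichotomy t 0 with h | h | h
  · simp [step_of_neg h]
  · subst h; norm_num [step]
  · simp [step_of_pos h]

theorem measurable_step : Measurable step :=
  ((measurable_id.div measurable_id.norm).const_add 1).div_const 2

/-- Half the sum of `w` and `|w|`; this is why the Heaviside function appears with the value `1/2`
at `0`. -/
theorem HasWeakGrad.posPart {w : E n → ℝ} {G : E n → E n} (hw : HasWeakGrad Ω w G) :
    HasWeakGrad Ω (fun x => max (w x) 0) (fun x => step (w x) • G x) := by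
  refine ((hw.add hw.abs).const_smul (1 / 2)).congr (.of_forall fun x => ?_)
    (.of_forall fun x => ?_)
  · simp only [Pi.smul_apply, Pi.add_apply, smul_eq_mul]
    rcases le_total (w x) 0 with h | h
    · simp [h, abs_of_nonpos h]
    · simp only [h, abs_of_nonneg h, sup_of_le_left]; ring
  · simp only [Pi.smul_apply, Pi.add_apply, step]
    module

/-! ### The Sobolev spaces as vector spaces -/

theorem HasWeakGrad.mem_W11 {u : E n → ℝ} {G : E n → E n} (h : HasWeakGrad Ω u G)
    (hu : IntegrableOn u Ω) (hG : IntegrableOn G Ω) : u ∈ W11 Ω :=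
  ⟨⟨G, h⟩, hu, hG.congr h.weakGrad_ae_eq.symm⟩

theorem W11Zero_hasWeakGrad {u : E n → ℝ} (hu : u ∈ W11Zero Ω) :
    HasWeakGrad Ω u (weakGrad Ω u) := weakGrad_spec hu.1.1

theorem gradient_add_test (φ χ : 𝓓(Ω, ℝ)) (x : E n) :
    gradient (φ + χ : 𝓓(Ω, ℝ)) x = gradient (φ : E n → ℝ) x + gradient (χ : E n → ℝ) x := by
  have h : HasFDerivAt (φ + χ : 𝓓(Ω, ℝ)) (fderiv ℝ φ x + fderiv ℝ χ x) x :=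
    (differentiable_test φ x).hasFDerivAt.add (differentiable_test χ x).hasFDerivAt
  simp only [gradient, h.fderiv, map_add]

theorem gradient_smul_test (c : ℝ) (φ : 𝓓(Ω, ℝ)) (x : E n) :
    gradient (c • φ : 𝓓(Ω, ℝ)) x = c • gradient (φ : E n → ℝ) x := by
  have h : HasFDerivAt (c • φ : 𝓓(Ω, ℝ)) (c • fderiv ℝ φ x) x :=
    (differentiable_test φ x).hasFDerivAt.const_smul c
  simp only [gradient, h.fderiv]
  exact map_smul (InnerProductSpace.toDual ℝ (E n)).symm.toLinearEquiv c _

theorem weakGrad_add_ae {u v : E n → ℝ} {G H : E n → E n} (hu : HasWeakGrad Ω u G)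
    (hv : HasWeakGrad Ω v H) :
    ∀ᵐ x ∂(volume.restrict (Ω : Set (E n))), weakGrad Ω (u + v) x = G x + H x :=
  (hu.add hv).weakGrad_ae_eq

theorem W11Zero_add {u v : E n → ℝ} (hu : u ∈ W11Zero Ω) (hv : v ∈ W11Zero Ω) :
    u + v ∈ W11Zero Ω := by
  have gu := W11Zero_hasWeakGrad hu
  have gv := W11Zero_hasWeakGrad hv
  obtain ⟨⟨-, iu, igu⟩, φ, hφ1, hφ2⟩ := hu
  obtain ⟨⟨-, iv, igv⟩, χ, hχ1, hχ2⟩ := hv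
  refine ⟨(gu.add gv).mem_W11 (iu.add iv) (igu.add igv), fun k => φ k + χ k, ?_, ?_⟩
  · refine squeeze_zero (fun k => integral_nonneg fun x => abs_nonneg _) (fun k => ?_)
      (by simpa only [add_zero] using hφ1.add hχ1)
    have i1 := (iu.sub (integrableOn_test (φ k))).abs
    have i2 := (iv.sub (integrableOn_test (χ k))).abs
    refine le_trans (integral_mono ((iu.add iv).sub (integrableOn_test (φ k + χ k))).abs
      (i1.add i2) fun x => ?_) (integral_add i1 i2).le
    change |u x + v x - (φ k x + χ k x)| ≤ |u x - φ k x| + |v x - χ k x|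
    rw [add_sub_add_comm]
    exact abs_add_le _ _
  · refine squeeze_zero (fun k => integral_nonneg fun x => norm_nonneg _) (fun k => ?_)
      (by simpa only [add_zero] using hφ2.add hχ2)
    have i1 := (igu.sub (integrableOn_gradient_test (φ k))).norm
    have i2 := (igv.sub (integrableOn_gradient_test (χ k))).norm
    refine le_trans (integral_mono_ae
      (((igu.add igv).congr (gu.add gv).weakGrad_ae_eq.symm).sub
        (integrableOn_gradient_test (φ k + χ k))).norm (i1.add i2) ?_) (integral_add i1 i2).le
    filter_upwards [weakGrad_add_ae gu gv] with x hx
    change ‖weakGrad Ω (u + v) x - gradient (φ k + χ k : 𝓓(Ω, ℝ)) x‖ ≤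
      ‖weakGrad Ω u x - gradient (φ k : E n → ℝ) x‖ + ‖weakGrad Ω v x - gradient (χ k : E n → ℝ) x‖
    rw [hx, gradient_add_test, add_sub_add_comm]
    exact norm_add_le _ _

theorem W11Zero_smul {u : E n → ℝ} (c : ℝ) (hu : u ∈ W11Zero Ω) : c • u ∈ W11Zero Ω := by
  have gu := W11Zero_hasWeakGrad hu
  obtain ⟨⟨-, iu, igu⟩, φ, hφ1, hφ2⟩ := hu
  refine ⟨(gu.const_smul c).mem_W11 (iu.smul c) (igu.smul c), fun k => c • φ k, ?_, ?_⟩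
  · have := hφ1.const_mul |c|
    rw [mul_zero] at this
    refine this.congr fun k => ?_
    rw [← integral_const_mul]
    refine integral_congr_ae (.of_forall fun x => ?_)
    change |c| * |u x - φ k x| = |c * u x - c * φ k x|
    rw [← abs_mul, mul_sub]
  · have := hφ2.const_mul |c|
    rw [mul_zero] at this
    refine this.congr fun k => ?_
    rw [← integral_const_mul]
    refine integral_congr_ae ?_
    filter_upwards [(gu.const_smul c).weakGrad_ae_eq] with x hx
    rw [hx, gradient_smul_test, Pi.smul_apply, ← smul_sub, norm_smul, Real.norm_eq_abs]

/-- Compact support in `Ω` makes the boundary irrelevant: mollifications with small radius are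
already test functions on `Ω`. -/
theorem HasWeakGrad.mem_W11Zero_of_compact {u : E n → ℝ} {G : E n → E n} (h : HasWeakGrad Ω u G)
    (hu : IntegrableOn u Ω) (hG : IntegrableOn G Ω) {K : Set (E n)} (hK : IsCompact K)
    (hKΩ : K ⊆ Ω) (hu0 : ∀ᵐ x ∂(volume.restrict (Ω : Set (E n))), x ∉ K → u x = 0)
    (hG0 : ∀ᵐ x ∂(volume.restrict (Ω : Set (E n))), x ∉ K → G x = 0) : u ∈ W11Zero Ω := by
  have happ := fun k : ℕ => h.exists_test_close hK hKΩ hu0 hG0 (ε := 1 / ((k : ℝ) + 1))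
    (by positivity)
  choose φ hφ1 hφ2 using happ
  refine ⟨h.mem_W11 hu hG, φ, ?_, ?_⟩
  · exact squeeze_zero (fun k => integral_nonneg fun x => abs_nonneg _) hφ1
      tendsto_one_div_add_atTop_nhds_zero_nat
  · refine squeeze_zero (fun k => integral_nonneg fun x => norm_nonneg _) (fun k => ?_)
      tendsto_one_div_add_atTop_nhds_zero_nat
    refine le_trans (le_of_eq (integral_congr_ae ?_)) (hφ2 k)
    filter_upwards [h.weakGrad_ae_eq] with x hx
    rw [hx]

theorem test_mem_W11Zero (φ : 𝓓(Ω, ℝ)) : (φ : E n → ℝ) ∈ W11Zero Ω :=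
  (hasWeakGrad_test φ).mem_W11Zero_of_compact (integrableOn_test φ) (integrableOn_gradient_test φ)
    φ.hasCompactSupport φ.tsupport_subset
    (.of_forall fun _ hx => image_eq_zero_of_notMem_tsupport hx)
    (.of_forall fun _ hx => gradient_eq_zero_of_notMem_tsupport hx)

/-! ### Fields with variable exponent growth -/

/-- A monotone Carathéodory field on `Ω` with growth of variable order `q - 1`. -/
structure FieldConditions (Ω : Opens (E n)) (q : E n → ℝ) (b : E n → E n → E n) (β C : ℝ) :
    Prop where
  q_meas : AEMeasurable q (volume.restrict Ω)
  q_bounds : ∀ᵐ x ∂(volume.restrict (Ω : Set (E n))), 1 ≤ q x ∧ q x ≤ β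
  b_meas : ∀ ξ, AEMeasurable (fun x => b x ξ) (volume.restrict Ω)
  b_cont : ∀ᵐ x ∂(volume.restrict (Ω : Set (E n))), Continuous (b x)
  monotone : ∀ᵐ x ∂(volume.restrict (Ω : Set (E n))), ∀ ξ η, 0 ≤ ⟪b x ξ - b x η, ξ - η⟫
  C_nonneg : 0 ≤ C
  growth : ∀ᵐ x ∂(volume.restrict (Ω : Set (E n))), ∀ ξ, ‖b x ξ‖ ≤ C * (‖ξ‖ ^ (q x - 1) + 1)

theorem ae_comp_smul {P : E n → Prop} (h : ∀ᵐ x, P x) {c : ℝ} (hc : c ≠ 0) :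
    ∀ᵐ x : E n, P (c • x) :=
  (Measure.quasiMeasurePreserving_smul volume hc).ae h

/-- Preimages of null sets under `x ↦ x / ε` are null, so the a.e. conditions and measurability
survive the rescaling, with constants independent of `ε`. -/
theorem StructureConditions.fieldConditions {p : E n → ℝ} {a : E n → E n → E n} {α β C₁ C₂ : ℝ}
    (h : StructureConditions p a α β C₁ C₂) (Ω : Opens (E n)) {ε : ℝ} (hε : 0 < ε) :
    FieldConditions Ω (pEps p ε) (aEps a ε) β C₂ := by
  have hε' : ε⁻¹ ≠ 0 := inv_ne_zero hε.ne'
  have hq := Measure.quasiMeasurePreserving_smul (volume : Measure (E n)) hε'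
  refine ⟨(h.p_meas.comp_quasiMeasurePreserving hq).restrict, ?_,
    fun ξ => ((h.a_meas ξ).comp_quasiMeasurePreserving hq).restrict, ?_, ?_, h.C₂_pos.le, ?_⟩
  · filter_upwards [ae_restrict_of_ae (ae_comp_smul h.p_bounds hε')] with x hx
    exact ⟨h.one_lt.le.trans hx.1, hx.2⟩
  · exact ae_restrict_of_ae (ae_comp_smul h.a_cont hε')
  · filter_upwards [ae_restrict_of_ae (ae_comp_smul h.monotone hε')] with x hx ξ η
    rcases eq_or_ne ξ η with rfl | hne
    · simp
    · exact (hx ξ η hne).le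
  · exact ae_restrict_of_ae (ae_comp_smul h.growth hε')

/-- Superposition with a Carathéodory function preserves measurability. -/
theorem aemeasurable_caratheodory {X Y Z : Type*} [MeasurableSpace X] {μ : Measure X}
    [TopologicalSpace Y] [PseudoMetrizableSpace Y] [SecondCountableTopology Y]
    [MeasurableSpace Y] [BorelSpace Y] [TopologicalSpace Z] [PseudoMetrizableSpace Z]
    [MeasurableSpace Z] [BorelSpace Z] {b : X → Y → Z} (hb : ∀ y, AEMeasurable (fun x => b x y) μ)
    (hc : ∀ᵐ x ∂μ, Continuous (b x)) {G : X → Y} (hG : AEStronglyMeasurable G μ) :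
    AEMeasurable (fun x => b x (G x)) μ := by
  -- Measurability is clear on each of the finitely many level sets of a simple function; continuity
  -- of `b x` then carries it to pointwise limits of simple functions.
  have hs : ∀ s : SimpleFunc X Y, AEMeasurable (fun x => b x (s x)) μ := fun s => by
    have hU : ⋃ y : s.range, s ⁻¹' {(y : Y)} = univ :=
      eq_univ_of_forall fun x => mem_iUnion.2 ⟨⟨s x, s.mem_range_self x⟩, rfl⟩
    rw [← Measure.restrict_univ (μ := μ), ← hU, aemeasurable_iUnion_iff]
    intro y
    refine (hb y).restrict.congr ?_
    filter_upwards [ae_restrict_mem (s.measurableSet_preimage {(y : Y)})] with x hx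
    rw [show s x = y from hx]
  have h1 : AEMeasurable (fun x => b x (hG.mk G x)) μ := by
    refine aemeasurable_of_tendsto_metrizable_ae atTop
      (fun k => hs (hG.stronglyMeasurable_mk.approx k)) ?_
    filter_upwards [hc] with x hx
    exact (hx.tendsto _).comp (hG.stronglyMeasurable_mk.tendsto_approx x)
  refine h1.congr ?_
  filter_upwards [hG.ae_eq_mk] with x hx
  rw [hx]

/-! ### Finiteness of the modular `∫ |F|^{q(x)}` under sums and multiples. -/

section Modular

variable {q : E n → ℝ} {β : ℝ} {F G H : E n → E n}

theorem add_rpow_le {s t q β : ℝ} (hs : 0 ≤ s) (ht : 0 ≤ t) (hq : 1 ≤ q) (hqβ : q ≤ β) :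
    (s + t) ^ q ≤ 2 ^ β * (s ^ q + t ^ q) := by
  have hs' := Real.rpow_nonneg hs q
  have ht' := Real.rpow_nonneg ht q
  calc (s + t) ^ q ≤ (2 * max s t) ^ q :=
        Real.rpow_le_rpow (by positivity) (by linarith [le_max_left s t, le_max_right s t])
          (by linarith)
    _ = 2 ^ q * max s t ^ q := Real.mul_rpow (by norm_num) (le_max_of_le_left hs)
    _ ≤ 2 ^ β * (s ^ q + t ^ q) := by
        refine mul_le_mul (Real.rpow_le_rpow_of_exponent_le (by norm_num) hqβ) ?_
          (Real.rpow_nonneg (le_max_of_le_left hs) _) (by positivity)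
        rcases max_choice s t with h | h <;> rw [h] <;> linarith

theorem aestronglyMeasurable_norm_rpow (hq : AEMeasurable q (volume.restrict Ω))
    (hF : AEStronglyMeasurable F (volume.restrict Ω)) :
    AEStronglyMeasurable (fun x => ‖F x‖ ^ q x) (volume.restrict Ω) :=
  (hF.norm.aemeasurable.pow hq).aestronglyMeasurable

theorem modular_add (hq : AEMeasurable q (volume.restrict Ω))
    (hqb : ∀ᵐ x ∂(volume.restrict (Ω : Set (E n))), 1 ≤ q x ∧ q x ≤ β)
    (hF : IntegrableOn F Ω) (hG : IntegrableOn G Ω)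
    (iF : IntegrableOn (fun x => ‖F x‖ ^ q x) Ω) (iG : IntegrableOn (fun x => ‖G x‖ ^ q x) Ω) :
    IntegrableOn (fun x => ‖F x + G x‖ ^ q x) Ω := by
  refine ((iF.add iG).const_mul (2 ^ β)).mono'
    (aestronglyMeasurable_norm_rpow hq (hF.add hG).1) ?_
  filter_upwards [hqb] with x hx
  rw [Real.norm_of_nonneg (by positivity)]
  exact (Real.rpow_le_rpow (norm_nonneg _) (norm_add_le _ _) (by linarith)).trans
    (add_rpow_le (norm_nonneg _) (norm_nonneg _) hx.1 hx.2)

theorem modular_mono {c : ℝ} (hc : 1 ≤ c) (hq : AEMeasurable q (volume.restrict Ω))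
    (hqb : ∀ᵐ x ∂(volume.restrict (Ω : Set (E n))), 1 ≤ q x ∧ q x ≤ β)
    (hG : AEStronglyMeasurable G (volume.restrict Ω))
    (iF : IntegrableOn (fun x => ‖F x‖ ^ q x) Ω) (h : ∀ x, ‖G x‖ ≤ c * ‖F x‖) :
    IntegrableOn (fun x => ‖G x‖ ^ q x) Ω := by
  refine (iF.const_mul (c ^ β)).mono' (aestronglyMeasurable_norm_rpow hq hG) ?_
  filter_upwards [hqb] with x hx
  rw [Real.norm_of_nonneg (by positivity)]
  refine (Real.rpow_le_rpow (norm_nonneg _) (h x) (by linarith)).trans ?_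
  rw [Real.mul_rpow (by linarith) (norm_nonneg _)]
  exact mul_le_mul_of_nonneg_right (Real.rpow_le_rpow_of_exponent_le hc hx.2) (by positivity)

theorem modular_smul (c : ℝ) (hq : AEMeasurable q (volume.restrict Ω))
    (hqb : ∀ᵐ x ∂(volume.restrict (Ω : Set (E n))), 1 ≤ q x ∧ q x ≤ β)
    (hF : IntegrableOn F Ω) (iF : IntegrableOn (fun x => ‖F x‖ ^ q x) Ω) :
    IntegrableOn (fun x => ‖c • F x‖ ^ q x) Ω :=
  modular_mono (c := max 1 |c|) (le_max_left _ _) hq hqb (hF.1.const_smul c) iF fun x => by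
    rw [norm_smul]
    exact mul_le_mul_of_nonneg_right (le_max_right _ _) (norm_nonneg _)

theorem modular_gradient_test (hΩ : volume (Ω : Set (E n)) ≠ ∞)
    (hq : AEMeasurable q (volume.restrict Ω))
    (hqb : ∀ᵐ x ∂(volume.restrict (Ω : Set (E n))), 1 ≤ q x ∧ q x ≤ β) (φ : 𝓓(Ω, ℝ)) :
    IntegrableOn (fun x => ‖gradient (φ : E n → ℝ) x‖ ^ q x) Ω := by
  obtain ⟨M, hM0, hM⟩ := exists_bound_gradient φ
  refine Integrable.mono' (g := fun _ => (max 1 M) ^ β) (integrableOn_const hΩ)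
    (aestronglyMeasurable_norm_rpow hq (continuous_gradient_test φ).aestronglyMeasurable) ?_
  filter_upwards [hqb] with x hx
  rw [Real.norm_of_nonneg (by positivity)]
  exact (Real.rpow_le_rpow (norm_nonneg _) ((hM x).trans (le_max_right _ _)) (by linarith)).trans
    (Real.rpow_le_rpow_of_exponent_le (le_max_left _ _) hx.2)

end Modular

theorem W1Zero_add {q : E n → ℝ} {β : ℝ} (hq : AEMeasurable q (volume.restrict Ω))
    (hqb : ∀ᵐ x ∂(volume.restrict (Ω : Set (E n))), 1 ≤ q x ∧ q x ≤ β) {u v : E n → ℝ}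
    (hu : u ∈ W1Zero Ω q) (hv : v ∈ W1Zero Ω q) : u + v ∈ W1Zero Ω q := by
  refine ⟨W11Zero_add hu.1 hv.1,
    (modular_add hq hqb hu.1.1.2.2 hv.1.1.2.2 hu.2 hv.2).congr ?_⟩
  filter_upwards [weakGrad_add_ae (W11Zero_hasWeakGrad hu.1) (W11Zero_hasWeakGrad hv.1)] with x hx
  rw [hx]

theorem W1Zero_smul {q : E n → ℝ} {β : ℝ} (hq : AEMeasurable q (volume.restrict Ω))
    (hqb : ∀ᵐ x ∂(volume.restrict (Ω : Set (E n))), 1 ≤ q x ∧ q x ≤ β) {u : E n → ℝ} (c : ℝ)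
    (hu : u ∈ W1Zero Ω q) : c • u ∈ W1Zero Ω q := by
  refine ⟨W11Zero_smul c hu.1, (modular_smul c hq hqb hu.1.1.2.2 hu.2).congr ?_⟩
  filter_upwards [((W11Zero_hasWeakGrad hu.1).const_smul c).weakGrad_ae_eq] with x hx
  rw [hx, Pi.smul_apply]

theorem test_mem_W1Zero {q : E n → ℝ} {β : ℝ} (hΩ : volume (Ω : Set (E n)) ≠ ∞)
    (hq : AEMeasurable q (volume.restrict Ω))
    (hqb : ∀ᵐ x ∂(volume.restrict (Ω : Set (E n))), 1 ≤ q x ∧ q x ≤ β) (φ : 𝓓(Ω, ℝ)) :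
    (φ : E n → ℝ) ∈ W1Zero Ω q := by
  refine ⟨test_mem_W11Zero φ, (modular_gradient_test hΩ hq hqb φ).congr ?_⟩
  filter_upwards [(hasWeakGrad_test φ).weakGrad_ae_eq] with x hx
  rw [hx]

/-- A crude Young inequality: `s ^ (q - 1) * t` is at most the `q`-th power of the larger of `s` and
`t`, and `t ≤ t ^ q + 1`. Its constants do not depend on `q`, so it can be integrated for a variable
exponent. -/
theorem rpow_sub_one_mul_le {s t q : ℝ} (hs : 0 ≤ s) (ht : 0 ≤ t) (hq : 1 ≤ q) :
    (s ^ (q - 1) + 1) * t ≤ s ^ q + 2 * t ^ q + 1 := by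
  have h0 : s ^ (q - 1) * t ≤ s ^ q + t ^ q := by
    have hs' := Real.rpow_nonneg hs q
    have ht' := Real.rpow_nonneg ht q
    have hpow : ∀ r : ℝ, 0 ≤ r → r ^ (q - 1) * r = r ^ q := fun r hr => by
      rcases hr.eq_or_lt with rfl | hr
      · rw [mul_zero, Real.zero_rpow (by linarith)]
      · rw [← Real.rpow_add_one hr.ne', sub_add_cancel]
    rcases le_total s t with h | h
    · have := mul_le_mul_of_nonneg_right (Real.rpow_le_rpow hs h (by linarith : 0 ≤ q - 1)) ht
      rw [hpow t ht] at this
      linarith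
    · have := mul_le_mul_of_nonneg_left h (Real.rpow_nonneg hs (q - 1))
      rw [hpow s hs] at this
      linarith
  have h1 : t ≤ t ^ q + 1 := by
    rcases le_total t 1 with h | h
    · linarith [Real.rpow_nonneg ht q]
    · linarith [Real.self_le_rpow_of_one_le h hq]
  linarith

/-- Growth of order `q - 1` is dual to the modular of order `q`: this makes all the pairings in the
variational inequality finite. -/
theorem FieldConditions.integrableOn_inner {q : E n → ℝ} {b : E n → E n → E n} {β C : ℝ}
    (hb : FieldConditions Ω q b β C) (hΩ : volume (Ω : Set (E n)) ≠ ∞) {F H : E n → E n}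
    (hF : IntegrableOn F Ω) (hH : IntegrableOn H Ω)
    (iF : IntegrableOn (fun x => ‖F x‖ ^ q x) Ω) (iH : IntegrableOn (fun x => ‖H x‖ ^ q x) Ω) :
    IntegrableOn (fun x => ⟪b x (F x), H x⟫) Ω := by
  have hm : AEStronglyMeasurable (fun x => b x (F x)) (volume.restrict Ω) :=
    (aemeasurable_caratheodory hb.b_meas hb.b_cont hF.1).aestronglyMeasurable
  have h1 : IntegrableOn (fun _ : E n => (1 : ℝ)) Ω := integrableOn_const hΩ
  refine (((iF.add (iH.const_mul 2)).add h1).const_mul C).mono' (hm.inner hH.1) ?_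
  filter_upwards [hb.q_bounds, hb.growth] with x hx hg
  calc ‖⟪b x (F x), H x⟫‖ ≤ ‖b x (F x)‖ * ‖H x‖ := norm_inner_le_norm _ _
    _ ≤ C * (‖F x‖ ^ (q x - 1) + 1) * ‖H x‖ := mul_le_mul_of_nonneg_right (hg _) (norm_nonneg _)
    _ ≤ C * (‖F x‖ ^ q x + 2 * ‖H x‖ ^ q x + 1) := by
        rw [mul_assoc]
        exact mul_le_mul_of_nonneg_left
          (rpow_sub_one_mul_le (norm_nonneg _) (norm_nonneg _) hx.1) hb.C_nonneg

/-! ### The localized Lewy–Stampacchia inequality -/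

theorem setIntegral_mul_test_sub {f : E n → ℝ} {v w : E n → ℝ}
    (hv : IntegrableOn (fun x => f x * v x) Ω) (hw : IntegrableOn (fun x => f x * w x) Ω) (c : ℝ) :
    ∫ x in Ω, f x * (c * (v x - w x)) =
      c * ((∫ x in Ω, f x * v x) - ∫ x in Ω, f x * w x) := by
  rw [← integral_sub hv hw, ← integral_const_mul]
  exact integral_congr_ae (.of_forall fun x => by ring)

/-- Raising the solution keeps it above the obstacle, so `u + φ` is an admissible competitor. -/
theorem IsObstacleSolution.divOp_nonneg {q : E n → ℝ} {b : E n → E n → E n} {β C : ℝ}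
    (hb : FieldConditions Ω q b β C) (hΩ : volume (Ω : Set (E n)) ≠ ∞) {f ψ u : E n → ℝ}
    (hu : IsObstacleSolution Ω (obstacleSet Ω (W1Zero Ω q) ψ) b f u) (φ : 𝓓(Ω, ℝ))
    (hφ : ∀ x, 0 ≤ φ x) : 0 ≤ divOp Ω b u φ - ∫ x in Ω, f x * φ x := by
  obtain ⟨⟨huV, huψ⟩, hvi⟩ := hu
  have h := hvi (u + φ) ⟨W1Zero_add hb.q_meas hb.q_bounds huV
    (test_mem_W1Zero hΩ hb.q_meas hb.q_bounds φ), by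
      filter_upwards [huψ] with x hx
      exact hx.trans (le_add_of_nonneg_right (hφ x))⟩
  rw [add_sub_cancel_left] at h
  have e2 : ∫ x in Ω, ⟪b x (weakGrad Ω u x), weakGrad Ω φ x⟫ = divOp Ω b u φ := by
    refine integral_congr_ae ?_
    filter_upwards [(hasWeakGrad_test φ).weakGrad_ae_eq] with x hx
    rw [hx]
  simp only [Pi.add_apply, add_sub_cancel_left] at h
  rw [e2] at h
  linarith

/-- The test functions `(φ - c w)⁺` used to localize on the set `{w = 0}`. -/
theorem penalized_mem_W1Zero {q : E n → ℝ} {β : ℝ} (hΩ : volume (Ω : Set (E n)) ≠ ∞)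
    (hq : AEMeasurable q (volume.restrict Ω))
    (hqb : ∀ᵐ x ∂(volume.restrict (Ω : Set (E n))), 1 ≤ q x ∧ q x ≤ β)
    {w : E n → ℝ} {D : E n → E n} (hw : HasWeakGrad Ω w D) (iw : IntegrableOn w Ω)
    (iD : IntegrableOn D Ω) (iDq : IntegrableOn (fun x => ‖D x‖ ^ q x) Ω)
    (hw0 : ∀ᵐ x ∂(volume.restrict (Ω : Set (E n))), 0 ≤ w x) (φ : 𝓓(Ω, ℝ)) {c : ℝ}
    (hc : 0 < c) :
    HasWeakGrad Ω (fun x => max (φ x - c * w x) 0)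
        (fun x => step (φ x - c * w x) • (gradient (φ : E n → ℝ) x - c • D x)) ∧
      IntegrableOn (fun x => step (φ x - c * w x) • (gradient (φ : E n → ℝ) x - c • D x)) Ω ∧
      IntegrableOn (fun x =>
        ‖step (φ x - c * w x) • (gradient (φ : E n → ℝ) x - c • D x)‖ ^ q x) Ω ∧
      (fun x => max (φ x - c * w x) 0) ∈ W1Zero Ω q := by
  have hy : HasWeakGrad Ω (fun x => φ x - c * w x)
      (fun x => gradient (φ : E n → ℝ) x - c • D x) :=
    ((hasWeakGrad_test φ).add (hw.const_smul (-c))).congr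
      (.of_forall fun x => by simp [sub_eq_add_neg]) (.of_forall fun x => by simp [sub_eq_add_neg])
  have iy : IntegrableOn (fun x => φ x - c * w x) Ω := (integrableOn_test φ).sub (iw.const_mul c)
  have iY : IntegrableOn (fun x => gradient (φ : E n → ℝ) x - c • D x) Ω :=
    (integrableOn_gradient_test φ).sub (iD.smul c)
  have hz := hy.posPart
  have hmZ : AEStronglyMeasurable
      (fun x => step (φ x - c * w x) • (gradient (φ : E n → ℝ) x - c • D x))
      (volume.restrict Ω) :=
    (measurable_step.comp_aemeasurable iy.1.aemeasurable).aestronglyMeasurable.smul iY.1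
  have hle : ∀ x, ‖step (φ x - c * w x) • (gradient (φ : E n → ℝ) x - c • D x)‖ ≤
      1 * ‖gradient (φ : E n → ℝ) x - c • D x‖ := fun x => by
    rw [norm_smul, Real.norm_of_nonneg (step_mem_Icc _).1]
    exact mul_le_mul_of_nonneg_right (step_mem_Icc _).2 (norm_nonneg _)
  have iZ : IntegrableOn (fun x => step (φ x - c * w x) •
      (gradient (φ : E n → ℝ) x - c • D x)) Ω :=
    (iY.norm.const_mul 1).mono' hmZ (.of_forall hle)
  have iYq : IntegrableOn (fun x => ‖gradient (φ : E n → ℝ) x - c • D x‖ ^ q x) Ω := by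
    have := modular_add hq hqb (integrableOn_gradient_test φ) (iD.smul (-c))
      (modular_gradient_test hΩ hq hqb φ) (modular_smul (-c) hq hqb iD iDq)
    simpa only [Pi.smul_apply, neg_smul, ← sub_eq_add_neg] using this
  have iZq : IntegrableOn (fun x =>
      ‖step (φ x - c * w x) • (gradient (φ : E n → ℝ) x - c • D x)‖ ^ q x) Ω :=
    modular_mono le_rfl hq hqb hmZ iYq hle
  -- Because `w ≥ 0`, the function `(φ - c w)⁺` vanishes off the support of `φ`; it therefore has
  -- zero boundary values although `w` need not have any.
  refine ⟨hz, iZ, iZq, hz.mem_W11Zero_of_compact iy.pos_part iZ φ.hasCompactSupport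
    φ.tsupport_subset ?_ ?_, iZq.congr ?_⟩
  · filter_upwards [hw0] with x hx hxK
    rw [image_eq_zero_of_notMem_tsupport hxK, zero_sub, max_eq_right]
    nlinarith
  -- Off the support of `φ` the argument of `step` is `-c w`: where `w > 0` the step is zero, and
  -- where `w = 0` the step is `1/2` but `D = 0` a.e.
  · filter_upwards [hw0, hw.ae_eq_zero_of_nonneg hw0] with x hx hx' hxK
    rcases hx.eq_or_lt with h0 | h0
    · rw [hx' h0.symm, gradient_eq_zero_of_notMem_tsupport hxK, smul_zero, sub_zero, smul_zero]
    · rw [image_eq_zero_of_notMem_tsupport hxK, step_of_neg (by nlinarith), zero_smul]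
  · filter_upwards [hz.weakGrad_ae_eq] with x hx
    rw [hx]

/-- As the penalty steepens, only the contact set `{w = 0}` retains the test function. -/
theorem tendsto_penalized {w t : ℝ} (hw : 0 ≤ w) (ht : 0 ≤ t) :
    Tendsto (fun k : ℕ => max (t - ((k : ℝ) + 1) * w) 0) atTop (𝓝 (if w = 0 then t else 0)) := by
  split_ifs with h
  · simp [h, ht]
  · have hw' : 0 < w := lt_of_le_of_ne hw (Ne.symm h)
    refine tendsto_const_nhds.congr' ?_
    filter_upwards [eventually_ge_atTop ⌈t / w⌉₊] with k hk
    have h1 : t / w ≤ k := (Nat.le_ceil _).trans (by exact_mod_cast hk)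
    rw [div_le_iff₀ hw'] at h1
    rw [max_eq_right]; nlinarith

theorem eventually_step_eq_zero {w : ℝ} (hw : 0 < w) (t : ℝ) :
    ∀ᶠ k : ℕ in atTop, step (t - ((k : ℝ) + 1) * w) = 0 := by
  filter_upwards [eventually_ge_atTop ⌈t / w⌉₊] with k hk
  have h1 : t / w ≤ k := (Nat.le_ceil _).trans (by exact_mod_cast hk)
  rw [div_le_iff₀ hw] at h1
  exact step_of_neg (by nlinarith)

/-- If `g = (A ψ - f)⁺`, then `A u - f ≤ g χ_{u = ψ}`. -/
theorem IsObstacleSolution.divOp_le {q : E n → ℝ} {b : E n → E n → E n} {β C : ℝ}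
    (hb : FieldConditions Ω q b β C) (hΩ : volume (Ω : Set (E n)) ≠ ∞) {f ψ u g : E n → ℝ}
    (hf : IntegrableOn f Ω) (hg : IntegrableOn g Ω) (hψ : ψ ∈ W1 Ω q)
    (hu : IsObstacleSolution Ω (obstacleSet Ω (W1Zero Ω q) ψ) b f u)
    (hpos : IsPosPart Ω (W1Zero Ω q) (obstacleResidual Ω b f ψ) g) (φ : 𝓓(Ω, ℝ))
    (hφ : ∀ x, 0 ≤ φ x) :
    divOp Ω b u φ - ∫ x in Ω, f x * φ x ≤
      ∫ x in Ω, g x * ((coincidenceSet Ω u ψ).indicator 1 x * φ x) := by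
  obtain ⟨⟨huV, huψ⟩, hvi⟩ := hu
  have gu : HasWeakGrad Ω u (weakGrad Ω u) := W11Zero_hasWeakGrad huV.1
  have gψ : HasWeakGrad Ω ψ (weakGrad Ω ψ) := weakGrad_spec hψ.1.1
  set U := weakGrad Ω u with hU
  set P := weakGrad Ω ψ with hP
  have iu : IntegrableOn u Ω := huV.1.1.2.1
  have iψ : IntegrableOn ψ Ω := hψ.1.2.1
  have iU : IntegrableOn U Ω := huV.1.1.2.2
  have iP : IntegrableOn P Ω := hψ.1.2.2
  have iUq : IntegrableOn (fun x => ‖U x‖ ^ q x) Ω := huV.2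
  have iPq : IntegrableOn (fun x => ‖P x‖ ^ q x) Ω := hψ.2.2
  set w : E n → ℝ := fun x => u x - ψ x with hw
  set D : E n → E n := fun x => U x - P x with hD
  have gw : HasWeakGrad Ω w D := (gu.add (gψ.const_smul (-1))).congr
    (.of_forall fun x => by simp [hw, sub_eq_add_neg])
    (.of_forall fun x => by simp [hD, sub_eq_add_neg])
  have iw : IntegrableOn w Ω := iu.sub iψ
  have iD : IntegrableOn D Ω := iU.sub iP
  have iDq : IntegrableOn (fun x => ‖D x‖ ^ q x) Ω := by
    have := modular_add hb.q_meas hb.q_bounds iU (iP.smul (-1 : ℝ)) iUq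
      (modular_smul (-1) hb.q_meas hb.q_bounds iP iPq)
    simpa only [Pi.smul_apply, neg_smul, one_smul, ← sub_eq_add_neg] using this
  have hw0 : ∀ᵐ x ∂(volume.restrict (Ω : Set (E n))), 0 ≤ w x :=
    huψ.mono fun x hx => sub_nonneg.2 hx
  have hc : ∀ k : ℕ, 0 < (k : ℝ) + 1 := fun k => by positivity
  have hpen := fun k : ℕ => penalized_mem_W1Zero hΩ hb.q_meas hb.q_bounds gw iw iD iDq hw0 φ (hc k)
  set y : ℕ → E n → ℝ := fun k x => φ x - ((k : ℝ) + 1) * w x with hy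
  set z : ℕ → E n → ℝ := fun k x => max (y k x) 0 with hz
  set Z : ℕ → E n → E n :=
    fun k x => step (y k x) • (gradient (φ : E n → ℝ) x - ((k : ℝ) + 1) • D x) with hZ
  obtain ⟨M, hM0, hM⟩ := exists_bound_test φ
  have hzφ : ∀ k, ∀ᵐ x ∂(volume.restrict (Ω : Set (E n))), |z k x| ≤ φ x := fun k => by
    filter_upwards [hw0] with x hx
    rw [abs_of_nonneg (le_max_right _ _)]
    exact max_le (by have := hc k; simp only [hy]; nlinarith) (hφ x)
  have hmz : ∀ k, AEStronglyMeasurable (z k) (volume.restrict Ω) := fun k =>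
    (hpen k).1.1.aestronglyMeasurable
  have iφ : ∀ {h : E n → ℝ}, IntegrableOn h Ω → IntegrableOn (fun x => h x * φ x) Ω := fun {h} hh => by
    refine (hh.norm.mul_const M).mono' (hh.1.mul φ.continuous.aestronglyMeasurable)
      (.of_forall fun x => ?_)
    rw [norm_mul]
    exact mul_le_mul_of_nonneg_left (hM x) (norm_nonneg _)
  have iz : ∀ {h : E n → ℝ}, IntegrableOn h Ω → ∀ k, IntegrableOn (fun x => h x * z k x) Ω := by
    intro h hh k
    refine (iφ hh.norm).mono' (hh.1.mul (hmz k)) ?_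
    filter_upwards [hzφ k] with x hx
    rw [norm_mul]
    exact mul_le_mul_of_nonneg_left hx (norm_nonneg _)
  have igφq := modular_gradient_test hΩ hb.q_meas hb.q_bounds φ
  have igφ := integrableOn_gradient_test φ
  -- comparison with the obstacle, for each parameter of the penalization
  have hstep : ∀ k, divOp Ω b u φ - ∫ x in Ω, f x * φ x ≤ (∫ x in Ω, g x * z k x) +
      ∫ x in Ω, step (y k x) * (⟪b x (U x), gradient (φ : E n → ℝ) x⟫ -
        ⟪b x (P x), gradient (φ : E n → ℝ) x⟫) := by
    intro k
    obtain ⟨gz, iZ, iZq, hzV⟩ := hpen k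
    set c : ℝ := (k : ℝ) + 1 with hck
    have hc0 : 0 < c := hc k
    -- The competitor is `u - (φ - z) / c`. It stays above `ψ` because `φ - z ≤ c w = c (u - ψ)`.
    -- After multiplication by `c`, the variational inequality bounds the residual of `u` at `φ` by
    -- its residual at `z`.
    set d : ℝ := -c⁻¹ with hd
    have hdiff : HasWeakGrad Ω (d • ((φ : E n → ℝ) + (-1 : ℝ) • z k))
        (d • (gradient (φ : E n → ℝ) + (-1 : ℝ) • Z k)) :=
      ((hasWeakGrad_test φ).add (gz.const_smul (-1))).const_smul d
    have hmem : u + d • ((φ : E n → ℝ) + (-1 : ℝ) • z k) ∈ obstacleSet Ω (W1Zero Ω q) ψ := by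
      refine ⟨W1Zero_add hb.q_meas hb.q_bounds huV (W1Zero_smul hb.q_meas hb.q_bounds d
        (W1Zero_add hb.q_meas hb.q_bounds (test_mem_W1Zero hΩ hb.q_meas hb.q_bounds φ)
          (W1Zero_smul hb.q_meas hb.q_bounds (-1) hzV))), ?_⟩
      filter_upwards with x
      simp only [Pi.add_apply, Pi.smul_apply, smul_eq_mul, hd]
      have h1 : φ x - c * w x ≤ z k x := le_max_left _ _
      have h2 : c⁻¹ * (φ x + -1 * z k x) ≤ c⁻¹ * (c * w x) :=
        mul_le_mul_of_nonneg_left (by linarith) (by positivity)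
      rw [inv_mul_cancel_left₀ hc0.ne'] at h2
      simp only [hw] at h2
      linarith
    have h := hvi _ hmem
    rw [add_sub_cancel_left] at h
    have jφ := hb.integrableOn_inner hΩ iU igφ iUq igφq
    have jZ : IntegrableOn (fun x => ⟪b x (U x), Z k x⟫) Ω := hb.integrableOn_inner hΩ iU iZ iUq iZq
    have jφP := hb.integrableOn_inner hΩ iP igφ iPq igφq
    have jZP : IntegrableOn (fun x => ⟪b x (P x), Z k x⟫) Ω := hb.integrableOn_inner hΩ iP iZ iPq iZq
    have e1 : ∫ x in Ω, f x * ((u + d • ((φ : E n → ℝ) + (-1 : ℝ) • z k)) x - u x) =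
        d * ((∫ x in Ω, f x * φ x) - ∫ x in Ω, f x * z k x) := by
      rw [← setIntegral_mul_test_sub (iφ hf) (iz hf k)]
      refine integral_congr_ae (.of_forall fun x => ?_)
      simp only [Pi.add_apply, Pi.smul_apply, smul_eq_mul]
      ring
    have e2 : ∫ x in Ω, ⟪b x (U x), weakGrad Ω (d • ((φ : E n → ℝ) + (-1 : ℝ) • z k)) x⟫ =
        d * (divOp Ω b u φ - ∫ x in Ω, ⟪b x (U x), Z k x⟫) := by
      rw [divOp, ← integral_sub jφ jZ, ← integral_const_mul]
      refine integral_congr_ae ?_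
      filter_upwards [hdiff.weakGrad_ae_eq] with x hx
      rw [hx]
      simp only [Pi.add_apply, Pi.smul_apply, inner_smul_right, inner_add_right]
      ring
    rw [e1, e2] at h
    have h3 : divOp Ω b u φ - ∫ x in Ω, ⟪b x (U x), Z k x⟫ ≤
        (∫ x in Ω, f x * φ x) - ∫ x in Ω, f x * z k x :=
      le_of_mul_le_mul_left (by rw [hd, neg_mul, neg_mul] at h; linarith) (inv_pos.2 hc0)
    -- The positive part enters only through `T(z) ≤ T⁺(z) = ∫ g z`: `z` itself is a candidate in
    -- the Riesz–Kantorovich supremum.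
    have hup : obstacleResidual Ω b f ψ (z k) ≤ ∫ x in Ω, g x * z k x :=
      (hpos (z k) hzV (.of_forall fun x => le_max_right _ _)).1
        ⟨z k, hzV, .of_forall fun x => ⟨le_max_right _ _, le_rfl⟩, rfl⟩
    have e3 : obstacleResidual Ω b f ψ (z k) =
        (∫ x in Ω, ⟪b x (P x), Z k x⟫) - ∫ x in Ω, f x * z k x := by
      rw [obstacleResidual]
      congr 1
      refine integral_congr_ae ?_
      filter_upwards [gz.weakGrad_ae_eq] with x hx
      rw [hx]
    rw [e3] at hup
    -- This compares the operators at `u` and at `ψ`. With `Z = step(y) (∇φ - c D)` and `D = ∇u -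
    -- ∇ψ`, monotonicity gives the term with `-c D` a favourable sign, so the large factor `c`
    -- disappears from the bound.
    have hmono : (∫ x in Ω, ⟪b x (U x), Z k x⟫) - (∫ x in Ω, ⟪b x (P x), Z k x⟫) ≤
        ∫ x in Ω, step (y k x) * (⟪b x (U x), gradient (φ : E n → ℝ) x⟫ -
          ⟪b x (P x), gradient (φ : E n → ℝ) x⟫) := by
      rw [← integral_sub jZ jZP]
      refine integral_mono_ae (jZ.sub jZP) ?_ ?_
      · refine (jφ.sub jφP).norm.mono' ((measurable_step.comp_aemeasurable
          (((integrableOn_test φ).sub (iw.const_mul c)).1.aemeasurable)).aestronglyMeasurable.mul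
            (jφ.sub jφP).1) (.of_forall fun x => ?_)
        rw [norm_mul, Real.norm_of_nonneg (step_mem_Icc _).1]
        exact mul_le_of_le_one_left (norm_nonneg _) (step_mem_Icc _).2
      · filter_upwards [hb.monotone] with x hx
        have h1 := hx (U x) (P x)
        simp only [inner_sub_left] at h1
        have h2 : 0 ≤ step (y k x) * (c * (⟪b x (U x), D x⟫ - ⟪b x (P x), D x⟫)) :=
          mul_nonneg (step_mem_Icc _).1 (mul_nonneg hc0.le h1)
        simp only [hZ, inner_smul_right, inner_sub_right (y := gradient (φ : E n → ℝ) x)]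
        linarith
    linarith
  -- passage to the limit
  have lim1 : Tendsto (fun k => ∫ x in Ω, g x * z k x) atTop
      (𝓝 (∫ x in Ω, g x * ((coincidenceSet Ω u ψ).indicator 1 x * φ x))) := by
    refine tendsto_integral_of_dominated_convergence (fun x => ‖g x‖ * φ x)
      (fun k => (iz hg k).1) (iφ hg.norm) (fun k => ?_) ?_
    · filter_upwards [hzφ k] with x hx
      rw [norm_mul]
      exact mul_le_mul_of_nonneg_left hx (norm_nonneg _)
    · filter_upwards [hw0, ae_restrict_mem Ω.isOpen.measurableSet] with x hx hxΩ
      refine Tendsto.const_mul _ ?_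
      convert tendsto_penalized hx (hφ x) using 2
      split_ifs with h
      · rw [indicator_of_mem (show x ∈ coincidenceSet Ω u ψ from ⟨hxΩ, sub_eq_zero.1 h⟩)]
        simp
      · rw [indicator_of_notMem fun hx' : x ∈ coincidenceSet Ω u ψ => h (sub_eq_zero.2 hx'.2),
          zero_mul]
  -- The remainder vanishes for two complementary reasons: on `{w = 0}` the gradients of `u` and `ψ`
  -- agree a.e., and on `{w > 0}` the step is eventually zero.
  have lim2 : Tendsto (fun k => ∫ x in Ω, step (y k x) *
      (⟪b x (U x), gradient (φ : E n → ℝ) x⟫ - ⟪b x (P x), gradient (φ : E n → ℝ) x⟫)) atTop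
      (𝓝 (∫ _ in (Ω : Set (E n)), (0 : ℝ))) := by
    have jd := (hb.integrableOn_inner hΩ iU igφ iUq igφq).sub
      (hb.integrableOn_inner hΩ iP igφ iPq igφq)
    refine tendsto_integral_of_dominated_convergence _ (fun k => ?_) jd.norm
      (fun k => .of_forall fun x => ?_) ?_
    · exact (measurable_step.comp_aemeasurable
        (((integrableOn_test φ).sub (iw.const_mul _)).1.aemeasurable)).aestronglyMeasurable.mul jd.1
    · rw [norm_mul, Real.norm_of_nonneg (step_mem_Icc _).1]
      exact mul_le_of_le_one_left (norm_nonneg _) (step_mem_Icc _).2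
    · filter_upwards [hw0, gw.ae_eq_zero_of_nonneg hw0] with x hx hx'
      rcases hx.eq_or_lt with h0 | h0
      · have : U x = P x := sub_eq_zero.1 (hx' h0.symm)
        simp [this]
      · refine tendsto_const_nhds.congr' ?_
        filter_upwards [eventually_step_eq_zero h0 (φ x)] with k hk
        simp only [hy, hk, zero_mul]
  have hlim := ge_of_tendsto' (lim1.add lim2) hstep
  simpa using hlim

/-! ### Nonnegative distributions and measures -/

/-- Extension by zero of a test function from a smaller open set. -/
noncomputable def testMono {Ω' : Opens (E n)} (h : (Ω' : Set (E n)) ⊆ Ω) (φ : 𝓓(Ω', ℝ)) :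
    𝓓(Ω, ℝ) :=
  ⟨φ, φ.contDiff, φ.hasCompactSupport, φ.tsupport_subset.trans h⟩

/-- Cutoffs equal to `1` on `K` and supported in shrinking neighbourhoods of `K` converge pointwise
to `1_K`. Their supports lie in one compact `L ⊆ Ω`, so `|h| 1_L` dominates. -/
theorem setIntegral_isCompact_nonneg_of_test {h : E n → ℝ} (hh : LocallyIntegrableOn h Ω)
    (hpos : ∀ φ : 𝓓(Ω, ℝ), (∀ x, 0 ≤ φ x) → 0 ≤ ∫ x in Ω, h x * φ x) {K : Set (E n)}
    (hK : IsCompact K) (hKΩ : K ⊆ Ω) : 0 ≤ ∫ x in K, h x := by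
  obtain ⟨L, hL, hKL, hLΩ⟩ := exists_compact_between hK Ω.isOpen hKΩ
  let Ω' : ℕ → Opens (E n) := fun k =>
    ⟨Metric.thickening (1 / ((k : ℝ) + 1)) K ∩ interior L,
      Metric.isOpen_thickening.inter isOpen_interior⟩
  have hΩ'L : ∀ k, (Ω' k : Set (E n)) ⊆ L := fun k => inter_subset_right.trans interior_subset
  have hKΩ' : ∀ k, K ⊆ Ω' k := fun k =>
    subset_inter (Metric.self_subset_thickening (by positivity) K) hKL
  choose η hη1 hη2 using fun k => exists_cutoff hK (hKΩ' k)
  let φ : ℕ → 𝓓(Ω, ℝ) := fun k => testMono ((hΩ'L k).trans hLΩ) (η k)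
  have hφη : ∀ k x, φ k x = η k x := fun k x => rfl
  have hiL : Integrable (L.indicator fun x => ‖h x‖) (volume.restrict Ω) :=
    ((integrable_indicator_iff hL.measurableSet).2
      (hh.integrableOn_compact_subset hLΩ hL).norm).restrict
  have lim : Tendsto (fun k => ∫ x in Ω, h x * φ k x) atTop
      (𝓝 (∫ x in Ω, K.indicator h x)) := by
    refine tendsto_integral_of_dominated_convergence _
      (fun k => hh.aestronglyMeasurable.mul (φ k).continuous.aestronglyMeasurable) hiL
      (fun k => .of_forall fun x => ?_) (.of_forall fun x => ?_)
    · by_cases hx : x ∈ L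
      · rw [indicator_of_mem hx, norm_mul, hφη, Real.norm_of_nonneg (hη2 k x).1]
        exact mul_le_of_le_one_right (norm_nonneg _) (hη2 k x).2
      · rw [hφη, image_eq_zero_of_notMem_tsupport fun hx' =>
          hx (hΩ'L k ((η k).tsupport_subset hx'))]
        simp [hx]
    · by_cases hx : x ∈ K
      · simp [hφη, (hη1 _ x hx).self_of_nhds, hx]
      · rw [indicator_of_notMem hx]
        refine tendsto_const_nhds.congr' ?_
        obtain ⟨ε, hε, hεK⟩ : ∃ ε, 0 < ε ∧ x ∉ Metric.thickening ε K := by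
          rw [← hK.isClosed.closure_eq, Metric.closure_eq_iInter_thickening] at hx
          simpa using hx
        filter_upwards [(tendsto_order.1 (tendsto_one_div_add_atTop_nhds_zero_nat (𝕜 := ℝ))).2 _ hε]
          with k hk
        rw [hφη, image_eq_zero_of_notMem_tsupport fun hx' =>
          hεK (Metric.thickening_mono hk.le K ((η k).tsupport_subset hx').1), mul_zero]
  have h0 := ge_of_tendsto' lim fun k => hpos (φ k) fun x => (hη2 k x).1
  rwa [setIntegral_indicator hK.measurableSet, inter_eq_right.2 hKΩ] at h0

/-- If `{h < 0}` had positive measure, inner regularity would give a compact `K` inside it of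
positive measure, and `∫_K h` would be negative. -/
theorem ae_nonneg_of_test {h : E n → ℝ} (hh : LocallyIntegrableOn h Ω)
    (hpos : ∀ φ : 𝓓(Ω, ℝ), (∀ x, 0 ≤ φ x) → 0 ≤ ∫ x in Ω, h x * φ x) :
    ∀ᵐ x ∂(volume.restrict (Ω : Set (E n))), 0 ≤ h x := by
  have hm : AEStronglyMeasurable h (volume.restrict Ω) := hh.aestronglyMeasurable
  set h' := hm.mk h with hh'
  have hS : MeasurableSet ((Ω : Set (E n)) ∩ {x | h' x < 0}) :=
    Ω.isOpen.measurableSet.inter (hm.stronglyMeasurable_mk.measurable measurableSet_Iio)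
  have hzero : volume ((Ω : Set (E n)) ∩ {x | h' x < 0}) = 0 := by
    by_contra hne
    obtain ⟨K, hKS, hK, hKpos⟩ := hS.exists_lt_isCompact (pos_iff_ne_zero.2 hne)
    have hKΩ : K ⊆ Ω := fun x hx => (hKS hx).1
    have e : ∀ᵐ x ∂(volume.restrict K), h x = h' x :=
      ae_mono (Measure.restrict_mono hKΩ le_rfl) hm.ae_eq_mk
    have hneg : ∀ᵐ x ∂(volume.restrict K), h x < 0 := by
      filter_upwards [e, ae_restrict_mem hK.measurableSet] with x hx hxK
      rw [hx]
      exact (hKS hxK).2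
    have h0 := setIntegral_isCompact_nonneg_of_test hh hpos hK hKΩ
    have hi : IntegrableOn h K := hh.integrableOn_compact_subset hKΩ hK
    have h1 : ∫ x in K, (-h) x = 0 := by
      refine le_antisymm ?_ (integral_nonneg_of_ae (hneg.mono fun x hx => ?_))
      · rw [integral_neg']; linarith
      · simp only [Pi.zero_apply, Pi.neg_apply]; linarith
    rw [integral_eq_zero_iff_of_nonneg_ae (hneg.mono fun x hx => by
      simp only [Pi.zero_apply, Pi.neg_apply]; linarith) hi.neg] at h1
    have : ∀ᵐ x ∂(volume.restrict K), False := by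
      filter_upwards [h1, hneg] with x hx hx'
      simp only [Pi.zero_apply, Pi.neg_apply] at hx
      linarith
    rw [eventually_false_iff_eq_bot, ae_eq_bot, Measure.restrict_eq_zero] at this
    exact hKpos.ne' this
  have h2 : ∀ᵐ x ∂(volume.restrict (Ω : Set (E n))), ¬ h' x < 0 := by
    rw [ae_restrict_iff' Ω.isOpen.measurableSet, ae_iff]
    convert hzero using 2
    ext x
    simp
  filter_upwards [h2, hm.ae_eq_mk] with x hx hx'
  rw [hx']
  exact not_lt.1 hx

/-- `Ω` is a countable union of compact sets, each of finite measure, and the complement of `Ω` is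
null. This gives access to the Lebesgue decomposition of `ν`. -/
theorem IsRadonOn.sigmaFinite {ν : Measure (E n)} (hν : IsRadonOn Ω ν) : SigmaFinite ν := by
  have := Ω.isOpen.locallyCompactSpace
  obtain ⟨K, hK, hKU⟩ : IsSigmaCompact (Ω : Set (E n)) :=
    isSigmaCompact_iff_sigmaCompactSpace.mpr inferInstance
  have hKΩ : ∀ k, K k ⊆ Ω := fun k => (subset_iUnion K k).trans hKU.subset
  refine ⟨⟨⟨fun k => K k ∪ (Ω : Set (E n))ᶜ, fun _ => trivial, fun k => ?_, ?_⟩⟩⟩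
  · refine (measure_union_le _ _).trans_lt ?_
    rw [hν.1, add_zero]
    exact hν.2 _ (hK k) (hKΩ k)
  · rw [← iUnion_union, hKU, union_compl_self]

theorem IsRadonOn.locallyIntegrableOn_rnDeriv {ν : Measure (E n)} (hν : IsRadonOn Ω ν) :
    LocallyIntegrableOn (fun x => (ν.rnDeriv volume x).toReal) Ω := by
  rw [locallyIntegrableOn_iff Ω.isOpen.isLocallyClosed]
  intro K hKΩ hK
  refine integrable_toReal_of_lintegral_ne_top (Measure.measurable_rnDeriv _ _).aemeasurable ?_
  exact ((Measure.setLIntegral_rnDeriv_le K).trans_lt (hν.2 K hK hKΩ)).ne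

/-- The densities of mutually singular measures have essentially disjoint supports. -/
theorem densities_disjoint {ν : Measure (E n)} {g : E n → ℝ}
    (hg : AEMeasurable g (volume.restrict Ω)) (h : densityMeasure Ω g ⟂ₘ ν) :
    ∀ᵐ x ∂(volume.restrict (Ω : Set (E n))), g x ≤ 0 ∨ (ν.rnDeriv volume x).toReal = 0 := by
  obtain ⟨A, hA, h1, h2⟩ := h
  rw [densityMeasure, withDensity_apply _ hA, lintegral_eq_zero_iff'
    hg.ennreal_ofReal.restrict, EventuallyEq, ae_restrict_iff' hA] at h1
  have h3 : ∫⁻ x in Aᶜ, ν.rnDeriv volume x = 0 :=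
    le_antisymm ((Measure.setLIntegral_rnDeriv_le _).trans h2.le) zero_le
  rw [lintegral_eq_zero_iff (Measure.measurable_rnDeriv _ _), EventuallyEq,
    ae_restrict_iff' hA.compl] at h3
  filter_upwards [h1, ae_restrict_of_ae h3] with x hx hx'
  by_cases hxA : x ∈ A
  · exact Or.inl (by simpa using hx hxA)
  · exact Or.inr (by simp [hx' hxA])

/-- Where both densities vanish, and off a Lebesgue null set carrying the singular part of `ν`, both
measures vanish on every Borel subset; nondegeneracy therefore makes this set null. -/
theorem ae_density_ne_zero {ν : Measure (E n)} [SigmaFinite ν] {g : E n → ℝ}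
    (hg : AEMeasurable g (volume.restrict Ω))
    (h_nondeg : ∀ S : Set (E n), MeasurableSet S → S ⊆ Ω → 0 < volume S →
      ∃ S' ⊆ S, MeasurableSet S' ∧ densityMeasure Ω g S' ≠ ν S') :
    ∀ᵐ x ∂(volume.restrict (Ω : Set (E n))), g x = 0 → (ν.rnDeriv volume x).toReal ≠ 0 := by
  obtain ⟨B, hB, hB1, hB2⟩ := Measure.mutuallySingular_singularPart ν volume
  -- `B` has full Lebesgue measure and no singular part of `ν`. The measurable representative of `g`
  -- makes `S` a Borel set, as nondegeneracy requires.
  set S : Set (E n) := (Ω : Set (E n)) ∩ B ∩ {x | hg.mk g x = 0} ∩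
    {x | (ν.rnDeriv volume x).toReal = 0} with hS
  have hSm : MeasurableSet S :=
    ((Ω.isOpen.measurableSet.inter hB).inter (hg.measurable_mk (measurableSet_singleton 0))).inter
      ((Measure.measurable_rnDeriv ν volume).ennreal_toReal (measurableSet_singleton 0))
  have hSΩ : S ⊆ Ω := fun x hx => hx.1.1.1
  have hfin : ∀ᵐ x : E n, ν.rnDeriv volume x < ∞ := Measure.rnDeriv_lt_top ν volume
  have hzero : volume S = 0 := by
    by_contra hne
    obtain ⟨S', hS'S, hS', hne'⟩ := h_nondeg S hSm hSΩ (pos_iff_ne_zero.2 hne)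
    apply hne'
    have e1 : densityMeasure Ω g S' = 0 := by
      rw [densityMeasure, withDensity_apply _ hS', lintegral_eq_zero_iff'
        hg.ennreal_ofReal.restrict, EventuallyEq, ae_restrict_iff' hS']
      filter_upwards [hg.ae_eq_mk] with x hx hxS
      have : hg.mk g x = 0 := (hS'S hxS).1.2
      simp [hx, this]
    have e2 : ν S' = 0 := by
      rw [Measure.haveLebesgueDecomposition_add ν volume, Measure.add_apply,
        withDensity_apply _ hS', lintegral_eq_zero_iff (Measure.measurable_rnDeriv _ _) |>.2,
        add_zero]
      · exact measure_mono_null (fun x hx => (hS'S hx).1.1.2) hB1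
      · rw [EventuallyEq, ae_restrict_iff' hS']
        filter_upwards [hfin] with x hx hxS
        have : (ν.rnDeriv volume x).toReal = 0 := (hS'S hxS).2
        exact ((ENNReal.toReal_eq_zero_iff _).1 this).resolve_right hx.ne
    rw [e1, e2]
  have h1 : ∀ᵐ x ∂(volume.restrict (Ω : Set (E n))), x ∉ S :=
    ae_restrict_of_ae (measure_eq_zero_iff_ae_notMem.1 hzero)
  have h2 : ∀ᵐ x ∂(volume.restrict (Ω : Set (E n))), x ∉ Bᶜ :=
    ae_restrict_of_ae (measure_eq_zero_iff_ae_notMem.1 hB2)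
  filter_upwards [h1, h2, hg.ae_eq_mk, ae_restrict_mem Ω.isOpen.measurableSet]
    with x hx hxB hxg hxΩ hg0 hd
  exact hx ⟨⟨⟨hxΩ, not_not.1 hxB⟩, by rw [mem_ofPred_eq, ← hxg, hg0]⟩, hd⟩

/-! ### Convergence of sets in measure -/

/-- If `∫_{A i} H → 0` and `H > 0` on the sets `A i`, then `μ (A i) → 0`. -/
theorem tendsto_measure_zero_of_lintegral {X ι : Type*} [MeasurableSpace X] {μ : Measure X}
    [IsFiniteMeasure μ] {l : Filter ι} {H : X → ℝ≥0∞} (hH : AEMeasurable H μ) {A : ι → Set X}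
    (hA : ∀ᶠ i in l, ∀ᵐ x ∂μ, x ∈ A i → 0 < H x)
    (hAm : ∀ᶠ i in l, NullMeasurableSet (A i) μ)
    (h : Tendsto (fun i => ∫⁻ x in A i, H x ∂μ) l (𝓝 0)) : Tendsto (fun i => μ (A i)) l (𝓝 0) := by
  set η : ℕ → ℝ≥0∞ := fun k => ((k : ℝ≥0∞) + 1)⁻¹ with hη
  have hη_anti : Antitone η := fun j k hjk => by
    simp only [hη]; gcongr
  have hη0 : Tendsto η atTop (𝓝 0) := by
    have := (tendsto_add_atTop_iff_nat 1).2 ENNReal.tendsto_inv_nat_nhds_zero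
    simpa [hη] using this
  -- The sets `{0 < H < η k}` decrease to the empty set, so in a finite measure space one of them is
  -- small; on the rest of `A i` Markov's inequality applies with threshold `η k`.
  set B : ℕ → Set X := fun k => {x | 0 < H x} ∩ {x | H x < η k} with hB
  have hBm : ∀ k, NullMeasurableSet (B k) μ := fun k =>
    (nullMeasurableSet_lt aemeasurable_const hH).inter
      (nullMeasurableSet_lt hH aemeasurable_const)
  have hBlim : Tendsto (fun k => μ (B k)) atTop (𝓝 0) := by
    have := tendsto_measure_iInter_atTop (μ := μ) hBm
      (fun j k hjk x hx => ⟨hx.1, hx.2.trans_le (hη_anti hjk)⟩) ⟨0, measure_ne_top _ _⟩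
    have he : ⋂ k, B k = ∅ := by
      rw [eq_empty_iff_forall_notMem]
      intro x hx
      rw [mem_iInter] at hx
      have h0 : 0 < H x := (hx 0).1
      obtain ⟨k, hk⟩ := ((tendsto_order.1 hη0).2 _ h0).exists
      exact absurd (hx k).2 hk.le.not_gt
    rwa [he, measure_empty] at this
  rw [ENNReal.tendsto_nhds_zero]
  intro δ hδ
  have hδ2 : 0 < δ / 2 := ENNReal.half_pos hδ.ne'
  obtain ⟨k, hk⟩ := ((ENNReal.tendsto_nhds_zero.1 hBlim) _ hδ2).exists
  have hηk : η k ≠ 0 := by simp [hη]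
  have hηk' : η k ≠ ∞ := by simp [hη]
  have h' : ∀ᶠ i in l, ∫⁻ x in A i, H x ∂μ ≤ η k * (δ / 2) :=
    (ENNReal.tendsto_nhds_zero.1 h) _ (pos_iff_ne_zero.2 (mul_ne_zero hηk hδ2.ne'))
  filter_upwards [h', hA, hAm] with i hi hiA hiAm
  have hsub : μ (A i) ≤ μ (B k) + μ ({x | η k ≤ H x} ∩ A i) := by
    refine (measure_mono_ae (t := B k ∪ ({x | η k ≤ H x} ∩ A i)) ?_).trans (measure_union_le _ _)
    filter_upwards [hiA] with x hx hxA
    rcases lt_or_ge (H x) (η k) with hlt | hge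
    · exact Or.inl ⟨hx hxA, hlt⟩
    · exact Or.inr ⟨hge, hxA⟩
  have hM : η k * μ ({x | η k ≤ H x} ∩ A i) ≤ η k * (δ / 2) := by
    have := mul_meas_ge_le_lintegral₀ (hH.restrict (s := A i)) (η k)
    rw [Measure.restrict_apply₀' hiAm] at this
    exact this.trans hi
  rw [ENNReal.mul_le_mul_iff_right hηk hηk'] at hM
  calc μ (A i) ≤ δ / 2 + δ / 2 := hsub.trans (add_le_add hk hM)
    _ = δ := ENNReal.add_halves δ

/-- The difference of the indicators is `1_{A \ B} - 1_{B \ A}`, and `‖1_S‖_r = μ(S)^{1/r}`. -/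
theorem tendsto_eLpNorm_indicator_sub {X ι : Type*} [MeasurableSpace X] {μ : Measure X}
    {l : Filter ι} {A : ι → Set X} {B : Set X} (hA : ∀ᶠ i in l, NullMeasurableSet (A i) μ)
    (hB : NullMeasurableSet B μ) (h1 : Tendsto (fun i => μ (A i \ B)) l (𝓝 0))
    (h2 : Tendsto (fun i => μ (B \ A i)) l (𝓝 0)) {r : ℝ≥0∞} (hr : 1 ≤ r) (hr' : r ≠ ∞) :
    Tendsto (fun i => eLpNorm ((A i).indicator (1 : X → ℝ) - B.indicator 1) r μ) l (𝓝 0) := by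
  have hr0 : r ≠ 0 := (zero_lt_one.trans_le hr).ne'
  have hpos : 0 < 1 / r.toReal := one_div_pos.2 (ENNReal.toReal_pos hr0 hr')
  have hpow : ∀ {m : ι → ℝ≥0∞}, Tendsto m l (𝓝 0) →
      Tendsto (fun i => m i ^ (1 / r.toReal)) l (𝓝 0) := fun {m} hm => by
    have := (ENNReal.continuous_rpow_const (y := 1 / r.toReal)).tendsto 0 |>.comp hm
    rwa [ENNReal.zero_rpow_of_pos hpos] at this
  have hsum := (hpow h1).add (hpow h2)
  rw [add_zero] at hsum
  refine tendsto_of_tendsto_of_tendsto_of_le_of_le' tendsto_const_nhds hsum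
    (.of_forall fun _ => zero_le) ?_
  filter_upwards [hA] with i hi
  have e : (A i).indicator (1 : X → ℝ) - B.indicator 1 =
      (A i \ B).indicator (fun _ => 1) - (B \ A i).indicator (fun _ => 1) := by
    ext x
    by_cases hxA : x ∈ A i <;> by_cases hxB : x ∈ B <;> simp [hxA, hxB]
  have m1 : NullMeasurableSet (A i \ B) μ := hi.diff hB
  have m2 : NullMeasurableSet (B \ A i) μ := hB.diff hi
  have hc : ∀ {S : Set X}, NullMeasurableSet S μ →
      AEStronglyMeasurable (S.indicator fun _ => (1 : ℝ)) μ := fun hS =>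
    (aestronglyMeasurable_const (b := (1 : ℝ))).indicator₀ hS
  rw [e]
  refine (eLpNorm_sub_le (hc m1) (hc m2) hr).trans ?_
  rw [eLpNorm_indicator_const₀ m1 hr0 hr', eLpNorm_indicator_const₀ m2 hr0 hr']
  simp

/-- For `α < n`, the bound `n α' / (n + α') ≥ 1` is equivalent to `(n - 1) (α' - 1) ≥ 1`, that is to
`(n - 1) / (α - 1) ≥ 1`. It makes `L^s` data integrable on the bounded set `Ω`. -/
theorem DataExponent.one_le {α s : ℝ} (hα : 1 < α) (h : DataExponent n α s) : 1 ≤ s := by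
  rcases lt_trichotomy α n with h1 | h1 | h1
  · refine le_trans ?_ (h.1 h1).le
    have h2 : 0 < α - 1 := by linarith
    have h3 : 0 < α / (α - 1) := div_pos (by linarith) h2
    have h4 : (0 : ℝ) < n := by linarith
    rw [le_div_iff₀ (by positivity), one_mul]
    have h5 : α / (α - 1) = 1 + 1 / (α - 1) := by field_simp; ring
    have h6 : 1 ≤ (n - 1) / (α - 1) := by rw [le_div_iff₀ h2]; linarith
    have h7 : ((n : ℝ) - 1) / (α - 1) = n * (1 / (α - 1)) - 1 / (α - 1) := by field_simp
    rw [h5]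
    nlinarith
  · exact (h.2.1 h1).le
  · exact (h.2.2 h1).ge

/-! ### Convergence of the coincidence sets -/

theorem nullMeasurableSet_coincidenceSet {u ψ : E n → ℝ} (hu : IntegrableOn u Ω)
    (hψ : IntegrableOn ψ Ω) : NullMeasurableSet (coincidenceSet Ω u ψ) (volume.restrict Ω) :=
  Ω.isOpen.measurableSet.nullMeasurableSet.inter
    (nullMeasurableSet_eq_fun hu.1.aemeasurable hψ.1.aemeasurable)

/-- Points of contact disappear in the limit outside the limit coincidence set. -/
theorem tendsto_measure_coincidenceSet_diff (hΩ : volume (Ω : Set (E n)) ≠ ∞) {ι : Type*}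
    {l : Filter ι} {u ψ : ι → E n → ℝ} {u₀ ψ₀ : E n → ℝ}
    (hu : ∀ᶠ i in l, IntegrableOn (u i) Ω ∧ IntegrableOn (ψ i) Ω) (hu₀ : IntegrableOn u₀ Ω)
    (hψ₀ : IntegrableOn ψ₀ Ω)
    (h : Tendsto (fun i => ∫ x in Ω, |(u i x - ψ i x) - (u₀ x - ψ₀ x)|) l (𝓝 0)) :
    Tendsto (fun i => volume.restrict (Ω : Set (E n))
      (coincidenceSet Ω (u i) (ψ i) \ coincidenceSet Ω u₀ ψ₀)) l (𝓝 0) := by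
  have : IsFiniteMeasure (volume.restrict (Ω : Set (E n))) := ⟨by
    rw [Measure.restrict_apply_univ]; exact hΩ.lt_top⟩
  have hm := nullMeasurableSet_coincidenceSet hu₀ hψ₀
  have hA : ∀ᶠ i in l, NullMeasurableSet
      (coincidenceSet Ω (u i) (ψ i) \ coincidenceSet Ω u₀ ψ₀) (volume.restrict Ω) :=
    hu.mono fun i hi => (nullMeasurableSet_coincidenceSet hi.1 hi.2).diff hm
  -- The weight `|u₀ - ψ₀|` is positive off the limit coincidence set, and on the coincidence set of
  -- `u i` it equals the integrand of `h`.
  refine tendsto_measure_zero_of_lintegral (H := fun x => ENNReal.ofReal |u₀ x - ψ₀ x|)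
    (hu₀.sub hψ₀).1.aemeasurable.norm.ennreal_ofReal (.of_forall fun i => .of_forall fun x hx => ?_)
    hA ?_
  · rw [ENNReal.ofReal_pos, abs_pos, sub_ne_zero]
    exact fun he => hx.2 ⟨hx.1.1, he⟩
  · have h' := (ENNReal.continuous_ofReal.tendsto 0).comp h
    rw [ENNReal.ofReal_zero] at h'
    refine tendsto_of_tendsto_of_tendsto_of_le_of_le' tendsto_const_nhds h'
      (.of_forall fun _ => zero_le) ?_
    filter_upwards [hu, hA] with i hi hAi
    have hint : Integrable (fun x => |(u i x - ψ i x) - (u₀ x - ψ₀ x)|) (volume.restrict Ω) :=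
      ((hi.1.sub hi.2).sub (hu₀.sub hψ₀)).abs
    rw [Function.comp, ofReal_integral_eq_lintegral_ofReal hint (.of_forall fun x => abs_nonneg _)]
    refine le_trans (le_of_eq (lintegral_congr_ae ?_)) (setLIntegral_le_lintegral _ _)
    filter_upwards [ae_restrict_mem₀ hAi] with x hx
    have h0 : u i x - ψ i x = 0 := sub_eq_zero.2 hx.1.2
    rw [h0, zero_sub, abs_neg]

theorem integrable_mul_indicator_mul_test {h : E n → ℝ} (hh : IntegrableOn h Ω) {S : Set (E n)}
    (hS : NullMeasurableSet S (volume.restrict Ω)) (φ : 𝓓(Ω, ℝ)) :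
    IntegrableOn (fun x => h x * (S.indicator 1 x * φ x)) Ω := by
  obtain ⟨M, hM0, hM⟩ := exists_bound_test φ
  have hm : AEStronglyMeasurable (S.indicator (1 : E n → ℝ)) (volume.restrict Ω) :=
    (aestronglyMeasurable_const (b := (1 : ℝ))).indicator₀ hS
  refine (hh.norm.mul_const M).mono' (hh.1.mul (hm.mul φ.continuous.aestronglyMeasurable))
    (.of_forall fun x => ?_)
  rw [norm_mul]
  refine mul_le_mul_of_nonneg_left ?_ (norm_nonneg _)
  by_cases hx : x ∈ S
  · simpa [hx] using hM x
  · simpa [hx] using hM0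

/-- If functionals `T i ≤ g i χ_{A i}` converge to `g₀ χ_B` and `g i → g₀` in `L¹`, and
`A i \ B` is asymptotically null, then `g₀ χ_{B \ A i} → 0` locally. -/
theorem tendsto_integral_indicator_diff {ι : Type*} {l : Filter ι}
    {g : ι → E n → ℝ} {g₀ : E n → ℝ} {A : ι → Set (E n)} {B : Set (E n)} {T : ι → ℝ}
    (hg : ∀ᶠ i in l, IntegrableOn (g i) Ω) (hg₀ : IntegrableOn g₀ Ω)
    (hg₀_nonneg : ∀ᵐ x ∂(volume.restrict (Ω : Set (E n))), 0 ≤ g₀ x)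
    (h : Tendsto (fun i => ∫ x in Ω, |g i x - g₀ x|) l (𝓝 0))
    (hA : ∀ᶠ i in l, NullMeasurableSet (A i) (volume.restrict Ω))
    (hB : NullMeasurableSet B (volume.restrict Ω))
    (hAB : Tendsto (fun i => volume.restrict (Ω : Set (E n)) (A i \ B)) l (𝓝 0))
    (φ : 𝓓(Ω, ℝ)) (hφ : ∀ x, 0 ≤ φ x)
    (hT : Tendsto T l (𝓝 (∫ x in Ω, g₀ x * (B.indicator 1 x * φ x))))
    (hTg : ∀ᶠ i in l, T i ≤ ∫ x in Ω, g i x * ((A i).indicator 1 x * φ x)) :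
    Tendsto (fun i => ∫ x in Ω, g₀ x * ((B \ A i).indicator 1 x * φ x)) l (𝓝 0) := by
  obtain ⟨M, hM0, hM⟩ := exists_bound_test φ
  have hsmall : Tendsto (fun i => ∫ x in A i \ B, g₀ x ∂(volume.restrict (Ω : Set (E n)))) l
      (𝓝 0) := Integrable.tendsto_setIntegral_nhds_zero hg₀ hAB
  -- This upper bound comes from `1_{B \ A} = 1_B - 1_A + 1_{A \ B}` and from `T i ≤ ∫ g i 1_A φ`:
  -- replacing `g i` by `g₀` costs `M` times their `L¹` distance, and the last indicator is
  -- controlled by absolute continuity of the integral of `g₀`.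
  have hup : Tendsto (fun i => ((∫ x in Ω, g₀ x * (B.indicator 1 x * φ x)) - T i) +
      M * (∫ x in Ω, |g i x - g₀ x|) +
      M * ∫ x in A i \ B, g₀ x ∂(volume.restrict (Ω : Set (E n)))) l (𝓝 0) := by
    have := ((hT.const_sub (∫ x in Ω, g₀ x * (B.indicator 1 x * φ x))).add
      (h.const_mul M)).add (hsmall.const_mul M)
    simpa using this
  refine tendsto_of_tendsto_of_tendsto_of_le_of_le' tendsto_const_nhds hup
    (.of_forall fun i => integral_nonneg_of_ae ?_) ?_
  · filter_upwards [hg₀_nonneg] with x hx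
    exact mul_nonneg hx (mul_nonneg (indicator_nonneg (fun _ _ => zero_le_one) _) (hφ x))
  filter_upwards [hg, hA, hTg] with i hgi hAi hTi
  have hABi := hAi.diff hB
  have i1 := integrable_mul_indicator_mul_test hg₀ hB φ
  have i2 := integrable_mul_indicator_mul_test hg₀ hAi φ
  have i3 := integrable_mul_indicator_mul_test hg₀ hABi φ
  have i4 := integrable_mul_indicator_mul_test hgi hAi φ
  have e1 : ∫ x in Ω, g₀ x * ((B \ A i).indicator 1 x * φ x) =
      (∫ x in Ω, g₀ x * (B.indicator 1 x * φ x)) - (∫ x in Ω, g₀ x * ((A i).indicator 1 x * φ x)) +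
        ∫ x in Ω, g₀ x * ((A i \ B).indicator 1 x * φ x) := by
    rw [← integral_sub i1 i2]
    refine Eq.trans (integral_congr_ae (.of_forall fun x => ?_)) (integral_add (i1.sub i2) i3)
    by_cases hxA : x ∈ A i <;> by_cases hxB : x ∈ B <;> simp [hxA, hxB]
  have e2 : (∫ x in Ω, g i x * ((A i).indicator 1 x * φ x)) -
      (∫ x in Ω, g₀ x * ((A i).indicator 1 x * φ x)) ≤ M * ∫ x in Ω, |g i x - g₀ x| := by
    rw [← integral_sub i4 i2, ← integral_const_mul]
    refine integral_mono (i4.sub i2) ((hgi.sub hg₀).abs.const_mul M) fun x => ?_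
    change g i x * ((A i).indicator 1 x * φ x) - g₀ x * ((A i).indicator 1 x * φ x) ≤
      M * |g i x - g₀ x|
    rw [← sub_mul, mul_comm M]
    refine (le_abs_self _).trans ?_
    rw [abs_mul]
    refine mul_le_mul_of_nonneg_left ?_ (abs_nonneg _)
    by_cases hx : x ∈ A i
    · simpa [hx] using hM x
    · simpa [hx] using hM0
  have e3 : ∫ x in Ω, g₀ x * ((A i \ B).indicator 1 x * φ x) ≤
      M * ∫ x in A i \ B, g₀ x ∂(volume.restrict (Ω : Set (E n))) := by
    rw [← integral_indicator₀ hABi, ← integral_const_mul]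
    refine integral_mono_ae i3 ((Integrable.indicator₀ hg₀ hABi).const_mul M) ?_
    filter_upwards [hg₀_nonneg] with x hx
    by_cases hxS : x ∈ A i \ B
    · simp only [hxS, indicator_of_mem, Pi.one_apply, one_mul]
      rw [mul_comm M]
      exact mul_le_mul_of_nonneg_left ((le_abs_self _).trans (hM x)) hx
    · simp only [hxS, not_false_eq_true, indicator_of_notMem, zero_mul, mul_zero, le_refl]
  linarith

/-- Local `L¹` convergence `g₀ χ_{D i} → 0` forces `|D i| → 0` when `g₀ > 0` on the sets `D i`. -/
theorem tendsto_measure_of_tendsto_integral_test (hΩ : volume (Ω : Set (E n)) ≠ ∞) {ι : Type*}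
    {l : Filter ι} {g₀ : E n → ℝ} {D : ι → Set (E n)} (hg₀ : IntegrableOn g₀ Ω)
    (hg₀_nonneg : ∀ᵐ x ∂(volume.restrict (Ω : Set (E n))), 0 ≤ g₀ x)
    (hpos : ∀ᶠ i in l, ∀ᵐ x ∂(volume.restrict (Ω : Set (E n))), x ∈ D i → 0 < g₀ x)
    (hD : ∀ᶠ i in l, NullMeasurableSet (D i) (volume.restrict Ω))
    (h : ∀ φ : 𝓓(Ω, ℝ), (∀ x, 0 ≤ φ x) →
      Tendsto (fun i => ∫ x in Ω, g₀ x * ((D i).indicator 1 x * φ x)) l (𝓝 0)) :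
    Tendsto (fun i => volume.restrict (Ω : Set (E n)) (D i)) l (𝓝 0) := by
  have : IsFiniteMeasure (volume.restrict (Ω : Set (E n))) := ⟨by
    rw [Measure.restrict_apply_univ]; exact hΩ.lt_top⟩
  rw [ENNReal.tendsto_nhds_zero]
  intro δ hδ
  have hδ2 : 0 < δ / 2 := ENNReal.half_pos hδ.ne'
  -- Test functions only see compact parts of `Ω`: the part outside `K` is paid for by half of `δ`,
  -- and on `K` the cutoff equals `1`.
  obtain ⟨K, hKΩ, hK, hKδ⟩ := Ω.isOpen.measurableSet.exists_isCompact_sdiff_lt hΩ hδ2.ne'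
  obtain ⟨η, hη1, hη2⟩ := exists_cutoff hK hKΩ
  have hDK : ∀ᶠ i in l, NullMeasurableSet (D i ∩ K) (volume.restrict Ω) :=
    hD.mono fun i hi => hi.inter hK.measurableSet.nullMeasurableSet
  have hlim : Tendsto (fun i => volume.restrict (Ω : Set (E n)) (D i ∩ K)) l (𝓝 0) := by
    refine tendsto_measure_zero_of_lintegral (H := fun x => ENNReal.ofReal (g₀ x))
      hg₀.1.aemeasurable.ennreal_ofReal ?_ hDK ?_
    · filter_upwards [hpos] with i hi
      filter_upwards [hi] with x hx hxD
      exact ENNReal.ofReal_pos.2 (hx hxD.1)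
    · have h' := (ENNReal.continuous_ofReal.tendsto 0).comp (h η fun x => (hη2 x).1)
      rw [ENNReal.ofReal_zero] at h'
      refine tendsto_of_tendsto_of_tendsto_of_le_of_le' tendsto_const_nhds h'
        (.of_forall fun _ => zero_le) ?_
      filter_upwards [hD, hDK] with i hi hiK
      rw [Function.comp, ofReal_integral_eq_lintegral_ofReal
        (integrable_mul_indicator_mul_test hg₀ hi η) (by
          filter_upwards [hg₀_nonneg] with x hx
          exact mul_nonneg hx (mul_nonneg (indicator_nonneg (fun _ _ => zero_le_one) _) (hη2 x).1))]
      refine le_trans (le_of_eq (lintegral_congr_ae ?_)) (setLIntegral_le_lintegral (D i ∩ K) _)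
      filter_upwards [ae_restrict_mem₀ hiK] with x hx
      simp [hx.1, (hη1 x hx.2).self_of_nhds]
  filter_upwards [(ENNReal.tendsto_nhds_zero.1 hlim) _ hδ2] with i hi
  have hc : volume.restrict (Ω : Set (E n)) Kᶜ ≤ δ / 2 := by
    rw [Measure.restrict_apply hK.measurableSet.compl, inter_comm, ← sdiff_eq]
    exact hKδ.le
  calc volume.restrict (Ω : Set (E n)) (D i)
      ≤ volume.restrict (Ω : Set (E n)) (D i ∩ K ∪ Kᶜ) := measure_mono fun x hx => by
        by_cases hxK : x ∈ K
        · exact Or.inl ⟨hx, hxK⟩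
        · exact Or.inr hxK
    _ ≤ δ / 2 + δ / 2 := (measure_union_le _ _).trans (add_le_add hi hc)
    _ = δ := ENNReal.add_halves δ

/-- The limit reaction `A₀ u₀ - f = (A₀ ψ₀ - f) χ₀` is nonnegative, so on the coincidence set
the nondegenerate measure `A₀ ψ₀ - f = g₀ dx - ν` has the positive density `g₀`. -/
theorem ae_density_pos_of_reaction_nonneg {ν : Measure (E n)} {g₀ : E n → ℝ} {B : Set (E n)}
    (hν : IsRadonOn Ω ν) (hg₀ : IntegrableOn g₀ Ω) (hsing : densityMeasure Ω g₀ ⟂ₘ ν)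
    (h_nondeg : ∀ S : Set (E n), MeasurableSet S → S ⊆ Ω → 0 < volume S →
      ∃ S' ⊆ S, MeasurableSet S' ∧ densityMeasure Ω g₀ S' ≠ ν S')
    (hB : NullMeasurableSet B (volume.restrict Ω))
    (hpos : ∀ φ : 𝓓(Ω, ℝ), (∀ x, 0 ≤ φ x) →
      0 ≤ ∫ x in Ω, (g₀ x - (ν.rnDeriv volume x).toReal) * B.indicator 1 x * φ x) :
    ∀ᵐ x ∂(volume.restrict (Ω : Set (E n))), x ∈ B →
      0 < g₀ x ∧ (ν.rnDeriv volume x).toReal = 0 := by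
  have := hν.sigmaFinite
  have hd : LocallyIntegrableOn (fun x => g₀ x - (ν.rnDeriv volume x).toReal) Ω :=
    hg₀.locallyIntegrableOn.sub hν.locallyIntegrableOn_rnDeriv
  have hm : AEStronglyMeasurable (B.indicator (1 : E n → ℝ)) (volume.restrict Ω) :=
    (aestronglyMeasurable_const (b := (1 : ℝ))).indicator₀ hB
  have hdB : LocallyIntegrableOn
      (fun x => (g₀ x - (ν.rnDeriv volume x).toReal) * B.indicator 1 x) Ω :=
    locallyIntegrableOn_mono hd (hd.aestronglyMeasurable.mul hm) fun x => by
      by_cases hx : x ∈ B <;> simp [hx]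
  filter_upwards [ae_nonneg_of_test hdB hpos, densities_disjoint hg₀.1.aemeasurable hsing,
    ae_density_ne_zero hg₀.1.aemeasurable h_nondeg] with x h1 h2 h3 hx
  rw [indicator_of_mem hx, Pi.one_apply, mul_one] at h1
  have h4 : 0 ≤ (ν.rnDeriv volume x).toReal := ENNReal.toReal_nonneg
  -- At most one of the two densities is nonzero. If `g₀ x ≤ 0`, then `g₀ - dν/dx ≥ 0` leaves no
  -- room for a positive density of `ν`.
  have h5 : (ν.rnDeriv volume x).toReal = 0 := by
    rcases h2 with h2 | h2
    · linarith
    · exact h2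
  refine ⟨lt_of_le_of_ne (by linarith) fun h0 => h3 h0.symm h5, h5⟩

end ObstacleHomogenization

/-! ### Convergence of the characteristic functions. -/

theorem theorem4p1 {n : ℕ} (hn : 0 < n)
    (Ω : Opens (E n)) (hΩ_conn : IsConnected (Ω : Set (E n)))
    (hΩ_bdd : Bornology.IsBounded (Ω : Set (E n)))
    (p : E n → ℝ) (a : E n → E n → E n) (α β C₁ C₂ : ℝ)
    (hstr : StructureConditions p a α β C₁ C₂)
    -- the right hand side, the obstacles and the solutions of the obstacle problems
    (s : ℝ) (hs : DataExponent n α s)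
    (f : E n → ℝ) (hf : MemLp f (ENNReal.ofReal s) (volume.restrict Ω))
    (ψ : ℝ → E n → ℝ) (ψ₀ : E n → ℝ)
    (hψ : ∀ ε, 0 < ε → ψ ε ∈ W1 Ω (pEps p ε))
    (hψ_pos : ∀ ε, 0 < ε → (fun x => max (ψ ε x) 0) ∈ W1Zero Ω (pEps p ε))
    (hψ₀ : ψ₀ ∈ Wh Ω (homFunctional p))
    (hψ₀_pos : (fun x => max (ψ₀ x) 0) ∈ WhZero Ω (homFunctional p))
    (u : ℝ → E n → ℝ) (u₀ : E n → ℝ)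
    (hu : ∀ ε, 0 < ε →
      IsObstacleSolution Ω (obstacleSet Ω (W1Zero Ω (pEps p ε)) (ψ ε)) (aEps a ε) f (u ε))
    (hu₀ : IsObstacleSolution Ω (obstacleSet Ω (WhZero Ω (homFunctional p)) ψ₀)
      (fun _ => homField p a) f u₀)
    (hMosco : MoscoConverges Ω p α (fun ε => obstacleSet Ω (W1Zero Ω (pEps p ε)) (ψ ε))
      (obstacleSet Ω (WhZero Ω (homFunctional p)) ψ₀))
    -- `g ε = (A_ε ψ_ε - f)⁺`, bounded in `L^s(Ω)`
    (g : ℝ → E n → ℝ)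
    (hg : ∀ ε, 0 < ε →
      IsPosPart Ω (W1Zero Ω (pEps p ε)) (obstacleResidual Ω (aEps a ε) f (ψ ε)) (g ε))
    (hg_mem : ∀ ε, 0 < ε → MemLp (g ε) (ENNReal.ofReal s) (volume.restrict Ω))
    (C : ℝ)
    (hg_bdd : ∀ ε, 0 < ε →
      eLpNorm (g ε) (ENNReal.ofReal s) (volume.restrict Ω) ≤ ENNReal.ofReal C)
    -- `A₀ ψ₀ - f` is the signed measure `g₀ dx - ν`, with `(A₀ ψ₀ - f)⁺ = g₀`
    (g₀ : E n → ℝ) (ν : Measure (E n))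
    (hg₀_int : IntegrableOn g₀ Ω)
    (hg₀_nonneg : ∀ᵐ x ∂(volume.restrict (Ω : Set (E n))), 0 ≤ g₀ x)
    (hg₀ : HasJordanDecomposition Ω
      (fun φ => divOp Ω (fun _ => homField p a) ψ₀ φ - (∫ x in Ω, f x * φ x))
      (densityMeasure Ω g₀) ν)
    -- `u_ε - ψ_ε → u₀ - ψ₀` in `L¹(Ω)`
    (h_diff : Tendsto (fun ε => ∫ x in Ω, |(u ε x - ψ ε x) - (u₀ x - ψ₀ x)|) (𝓝[>] 0) (𝓝 0))
    -- `(A_ε ψ_ε - f)⁺ → (A₀ ψ₀ - f)⁺` in `L¹(Ω)`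
    (h_pos : Tendsto (fun ε => ∫ x in Ω, |g ε x - g₀ x|) (𝓝[>] 0) (𝓝 0))
    -- `A_ε u_ε → A₀ u₀` in the sense of distributions
    (h_op : ∀ φ : 𝓓(Ω, ℝ), Tendsto (fun ε => divOp Ω (aEps a ε) (u ε) φ) (𝓝[>] 0)
      (𝓝 (divOp Ω (fun _ => homField p a) u₀ φ)))
    -- the measure `A₀ ψ₀ - f` does not vanish on any set of positive Lebesgue measure
    (h_nondeg : ∀ S : Set (E n), MeasurableSet S → S ⊆ Ω → 0 < volume S →
      ∃ S' ⊆ S, MeasurableSet S' ∧ densityMeasure Ω g₀ S' ≠ ν S')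
    -- `A₀ u₀ - f = (A₀ ψ₀ - f) χ₀` a.e. in `Ω`
    (h_id : ∀ φ : 𝓓(Ω, ℝ),
      divOp Ω (fun _ => homField p a) u₀ φ - (∫ x in Ω, f x * φ x) =
        ∫ x in Ω, (g₀ x - (ν.rnDeriv volume x).toReal) *
          (coincidenceSet Ω u₀ ψ₀).indicator 1 x * φ x)
    (r : ℝ≥0∞) (hr : 1 ≤ r) (hr' : r ≠ ∞) :
    Tendsto (fun ε => eLpNorm ((coincidenceSet Ω (u ε) (ψ ε)).indicator (1 : E n → ℝ) -
        (coincidenceSet Ω u₀ ψ₀).indicator 1) r (volume.restrict Ω)) (𝓝[>] 0) (𝓝 0) := by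
  have hvol : volume (Ω : Set (E n)) ≠ ∞ := hΩ_bdd.measure_lt_top.ne
  have : IsFiniteMeasure (volume.restrict (Ω : Set (E n))) := ⟨by
    rw [Measure.restrict_apply_univ]; exact hvol.lt_top⟩
  have hs1 : 1 ≤ ENNReal.ofReal s := by
    rw [← ENNReal.ofReal_one]
    exact ENNReal.ofReal_le_ofReal (hs.one_le hstr.one_lt)
  have hfi : IntegrableOn f Ω := hf.integrable hs1
  have hgi : ∀ ε, 0 < ε → IntegrableOn (g ε) Ω := fun ε hε => (hg_mem ε hε).integrable hs1
  have hui : ∀ ε, 0 < ε → IntegrableOn (u ε) Ω := fun ε hε => (hu ε hε).1.1.1.1.2.1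
  have hψi : ∀ ε, 0 < ε → IntegrableOn (ψ ε) Ω := fun ε hε => (hψ ε hε).1.2.1
  have hu₀i : IntegrableOn u₀ Ω := hu₀.1.1.1.1.2.1
  have hψ₀i : IntegrableOn ψ₀ Ω := hψ₀.1.2.1
  have hev : ∀ᶠ ε : ℝ in 𝓝[>] 0, 0 < ε := self_mem_nhdsWithin
  have hfield := fun ε (hε : 0 < ε) => hstr.fieldConditions Ω hε
  have hA : ∀ᶠ ε in 𝓝[>] 0, NullMeasurableSet (coincidenceSet Ω (u ε) (ψ ε))
      (volume.restrict Ω) :=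
    hev.mono fun ε hε => nullMeasurableSet_coincidenceSet (hui ε hε) (hψi ε hε)
  have hB : NullMeasurableSet (coincidenceSet Ω u₀ ψ₀) (volume.restrict Ω) :=
    nullMeasurableSet_coincidenceSet hu₀i hψ₀i
  have h1 : Tendsto (fun ε => volume.restrict (Ω : Set (E n))
      (coincidenceSet Ω (u ε) (ψ ε) \ coincidenceSet Ω u₀ ψ₀)) (𝓝[>] 0) (𝓝 0) :=
    tendsto_measure_coincidenceSet_diff hvol (hev.mono fun ε hε => ⟨hui ε hε, hψi ε hε⟩)
      hu₀i hψ₀i h_diff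
  have hT : ∀ φ : 𝓓(Ω, ℝ), Tendsto (fun ε => divOp Ω (aEps a ε) (u ε) φ - ∫ x in Ω, f x * φ x)
      (𝓝[>] 0) (𝓝 (∫ x in Ω, (g₀ x - (ν.rnDeriv volume x).toReal) *
        (coincidenceSet Ω u₀ ψ₀).indicator 1 x * φ x)) := fun φ => by
    rw [← h_id φ]
    exact (h_op φ).sub_const _
  -- The sign of the limit reaction is inherited from the problems at level `ε` by distributional
  -- convergence.
  have hpos : ∀ᵐ x ∂(volume.restrict (Ω : Set (E n))), x ∈ coincidenceSet Ω u₀ ψ₀ →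
      0 < g₀ x ∧ (ν.rnDeriv volume x).toReal = 0 :=
    ae_density_pos_of_reaction_nonneg hg₀.2.1 hg₀_int hg₀.2.2.1 h_nondeg hB fun φ hφ =>
      ge_of_tendsto (hT φ) (hev.mono fun ε hε =>
        (hu ε hε).divOp_nonneg (hfield ε hε) hvol φ hφ)
  have h2 : Tendsto (fun ε => volume.restrict (Ω : Set (E n))
      (coincidenceSet Ω u₀ ψ₀ \ coincidenceSet Ω (u ε) (ψ ε))) (𝓝[>] 0) (𝓝 0) := by
    refine tendsto_measure_of_tendsto_integral_test hvol hg₀_int hg₀_nonneg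
      (.of_forall fun ε => hpos.mono fun x hx hxD => (hx hxD.1).1)
      (hA.mono fun ε hε => hB.diff hε) fun φ hφ => ?_
    refine tendsto_integral_indicator_diff (hev.mono hgi) hg₀_int hg₀_nonneg h_pos hA hB h1 φ hφ
      (T := fun ε => divOp Ω (aEps a ε) (u ε) φ - ∫ x in Ω, f x * φ x) ?_
      (hev.mono fun ε hε => (hu ε hε).divOp_le (hfield ε hε) hvol hfi (hgi ε hε) (hψ ε hε)
        (hg ε hε) φ hφ)
    -- On the limit coincidence set the density of `ν` vanishes a.e., so the limit reaction is `g₀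
    -- χ₀`.
    convert hT φ using 2
    refine integral_congr_ae ?_
    filter_upwards [hpos] with x hx
    by_cases hxB : x ∈ coincidenceSet Ω u₀ ψ₀
    · simp [hxB, (hx hxB).2]
    · simp [hxB]
  exact tendsto_eLpNorm_indicator_sub hA hB h1 h2 hr hr'
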